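/- Consider the class of equations $$u_t+uu_x+hu=g(t)u_{xx},$$ where the arbitrary elements are a real constant $h$ and a smooth nowhere vanishing function $g=g(t)$. A (local) generalized equivalence transformation of this class is a smooth map $(t,x,u,h,g)\mapsto(\tilde t,\tilde x,\tilde u,\tilde h,\tilde g)$ with nonvanishing Jacobian, defined on a product of open intervals in the space of $(t,x,u,h,g)$, $g\neq0$, such that for every equation of the class (with the values of its arbitrary elements in these intervals) the components for $t,x,u$, evaluated at the given constant $h$ and at $g=g(t)$, form a point transformation which maps this equation to an equation of the class, whose arbitrary elements are the constant $\tilde h$ and the function $\tilde g=\tilde g(\tilde t)$ given by the last two components. Here "maps" means that the prolongation of the point transformation maps the manifolds defined by the equations in the second-order jet space to each other. For $h\in\mathbb R$ put $$\tau=\tau_h(t)=\frac{e^{-ht}-1}{-h}\ \text{ if } h\neq0,\qquad \tau=\tau_0(t)=t\ \text{ if } h=0 .$$ Then the generalized equivalence transformations of the class (the generalized equivalence group $\hat G^\sim_{n=1,\,h=\mathrm{const}}$) are exactly the transformations $$\tilde t=T(t),\qquad \tilde x=(x+\mu_1\tau+\mu_0)X^1,$$ $$\tilde u=\frac{e^{ht-\tilde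 hT}}{\Delta X^1}\left(u+(x+\mu_1\tau+\mu_0)\frac{X^1_t}{X^1}+\mu_1e^{-ht}\right),\qquad \tilde g=\frac1\Delta e^{ht-\tilde hT}g,$$ where $X^1=(\gamma\tau+\delta)^{-1}$, $\Delta=\alpha\delta-\beta\gamma\neq0$, and the function $T=T(t)$, which depends on $h$ and $\tilde h$, is defined by $$\tau_{\tilde h}(T)=\frac{\alpha\tau_h(t)+\beta}{\gamma\tau_h(t)+\delta},$$ that is, $$h\tilde h\neq0:\ \frac{e^{-\tilde hT}-1}{-\tilde h}=\frac{\alpha\frac{e^{-ht}-1}{-h}+\beta}{\gamma\frac{e^{-ht}-1}{-h}+\delta};\qquad h\neq0,\ \tilde h=0:\ T=\frac{\alpha\frac{e^{-ht}-1}{-h}+\beta}{\gamma\frac{e^{-ht}-1}{-h}+\delta};$$ $$h=0,\ \tilde h\neq0:\ \frac{e^{-\tilde hT}-1}{-\tilde h}=\frac{\alpha t+\beta}{\gamma t+\delta};\qquad h=\tilde h=0:\ T=\frac{\alpha t+\beta}{\gamma t+\delta}.$$ Here $\alpha,\beta,\gamma,\delta,\mu_0,\mu_1$ are arbitrary constants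 with $\Delta\neq0$ (such that $\gamma\tau+\delta\neq0$ on the domain), constant in the sense that they depend neither on $t,x,u$ nor on $g$. They may depend smoothly on the constant arbitrary element $h$, and $\tilde h=\tilde h(h)$ is an arbitrary smooth function of $h$ with nonvanishing derivative. -/

import Mathlib

open Set Filter Topology
open scoped ContDiff

/-- An open nonempty (possibly unbounded) interval of the real line. -/
structure IsOpenInterval (S : Set ℝ) : Prop where
  isOpen : IsOpen S
  ordConnected : S.OrdConnected
  nonempty : S.Nonempty

namespace Burgers

/-- Points `(t, x, u)`: independent variables and dependent variable. -/
abbrev BasePt : Type := ℝ × ℝ × ℝ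

/-- Points `(t, x, u, h, g)`: the variables together with the arbitrary elements. -/
abbrev ExtPt : Type := ℝ × ℝ × ℝ × ℝ × ℝ

/-- The partial derivative with respect to `t`. -/
noncomputable def dt (u : ℝ × ℝ → ℝ) (z : ℝ × ℝ) : ℝ := deriv (fun s => u (s, z.2)) z.1

/-- The partial derivative with respect to `x`. -/
noncomputable def dx (u : ℝ × ℝ → ℝ) (z : ℝ × ℝ) : ℝ := deriv (fun y => u (z.1, y)) z.2

/-- The equation `u_t + u u_x + h u = g(t) u_xx` (with constant `h`) holds for the function `u`
at the point `z = (t, x)`. -/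
def SatisfiesAt (h : ℝ) (g : ℝ → ℝ) (u : ℝ × ℝ → ℝ) (z : ℝ × ℝ) : Prop :=
  dt u z + u z * dx u z + h * u z = g z.1 * dx (dx u) z

/-- `g` is an admissible value of the functional arbitrary element on the `t`-domain `S`:
it is smooth and does not vanish. -/
def IsAdmissibleCoeff (S : Set ℝ) (g : ℝ → ℝ) : Prop :=
  ContDiffOn ℝ ∞ g S ∧ ∀ t ∈ S, g t ≠ 0

/-- A point transformation of the open set `D` of `(t, x, u)`-space:
a smooth map with nonvanishing Jacobian determinant. -/
def IsPointTransformation (φ : BasePt → BasePt) (D : Set BasePt) : Prop :=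
  ContDiffOn ℝ ∞ φ D ∧ ∀ p ∈ D, (fderiv ℝ φ p).det ≠ 0

/-- The new independent variables `(t', x')` along the graph of `u`. -/
def baseAlong (φ : BasePt → BasePt) (u : ℝ × ℝ → ℝ) (w : ℝ × ℝ) : ℝ × ℝ :=
  ((φ (w.1, w.2, u w)).1, (φ (w.1, w.2, u w)).2.1)

/-- The new dependent variable `u'` along the graph of `u`. -/
def valueAlong (φ : BasePt → BasePt) (u : ℝ × ℝ → ℝ) (w : ℝ × ℝ) : ℝ :=
  (φ (w.1, w.2, u w)).2.2

/-- The point transformation `φ` maps the equation with coefficients `(h, g)` to the equation with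
coefficients `(h', g')`: its prolongation maps the manifold of the first equation in the
second-order jet space to that of the second one. Jets are represented by (germs of) smooth
functions: whenever `φ` maps the graph of `u` near `z` to the graph of `v`, the function `u`
satisfies the first equation at `z` if and only if `v` satisfies the second one at the image of `z`. -/
def MapsEquation (φ : BasePt → BasePt) (D : Set BasePt)
    (h : ℝ) (g : ℝ → ℝ) (h' : ℝ) (g' : ℝ → ℝ) : Prop :=
  ∀ (u v : ℝ × ℝ → ℝ) (z : ℝ × ℝ),
    (z.1, z.2, u z) ∈ D →
    ContDiffAt ℝ ∞ u z →
    (fderiv ℝ (baseAlong φ u) z).det ≠ 0 →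
    ContDiffAt ℝ ∞ v (baseAlong φ u z) →
    (∀ᶠ w in 𝓝 z, v (baseAlong φ u w) = valueAlong φ u w) →
    (SatisfiesAt h g u z ↔ SatisfiesAt h' g' v (baseAlong φ u z))

/-- The components of `Φ` for `t, x, u`, where the arbitrary elements are given the constant
value `h` and the functional value `g = g(t)`. -/
def restrict (Φ : ExtPt → ExtPt) (h : ℝ) (g : ℝ → ℝ) (p : BasePt) : BasePt :=
  ((Φ (p.1, p.2.1, p.2.2, h, g p.1)).1, (Φ (p.1, p.2.1, p.2.2, h, g p.1)).2.1,
    (Φ (p.1, p.2.1, p.2.2, h, g p.1)).2.2.1)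

/-- `Φ` is a (local) generalized equivalence transformation, with domain
`I × J × K × L × M` in the space of `(t, x, u, h, g)`, of the class of the equations
`u_t + u u_x + h u = g(t) u_xx` with constant `h` and smooth nonvanishing `g`:
* `Φ` is a point transformation of the space of variables and arbitrary elements; its components
  for `t, x, u` may depend on the arbitrary elements as well;
* for every equation of the class, the components for `t, x, u` become a point transformation, and
  it maps the equation to the equation of the class whose arbitrary elements (a constant `h'` and a
  function `g'` of the new time) are given by the other two components of `Φ`. -/
def IsGeneralizedEquivalence (Φ : ExtPt → ExtPt) (I J K L M : Set ℝ) : Prop :=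
  ContDiffOn ℝ ∞ Φ (I ×ˢ J ×ˢ K ×ˢ L ×ˢ M) ∧
  (∀ q ∈ I ×ˢ J ×ˢ K ×ˢ L ×ˢ M, (fderiv ℝ Φ q).det ≠ 0) ∧
  ∀ (S : Set ℝ) (h : ℝ) (g : ℝ → ℝ), IsOpenInterval S → S ⊆ I → h ∈ L →
    IsAdmissibleCoeff S g → MapsTo g S M →
    IsPointTransformation (restrict Φ h g) (S ×ˢ J ×ˢ K) ∧
    ∃ (h' : ℝ) (g' : ℝ → ℝ),
      IsAdmissibleCoeff ((fun p => (restrict Φ h g p).1) '' (S ×ˢ J ×ˢ K)) g' ∧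
      (∀ p ∈ S ×ˢ J ×ˢ K,
        (Φ (p.1, p.2.1, p.2.2, h, g p.1)).2.2.2.1 = h' ∧
        (Φ (p.1, p.2.1, p.2.2, h, g p.1)).2.2.2.2 = g' (restrict Φ h g p).1) ∧
      MapsEquation (restrict Φ h g) (S ×ˢ J ×ˢ K) h g h' g'

/-- `(e^{-ht} - 1)/(-h)` for `h ≠ 0`, and `t` for `h = 0`. -/
noncomputable def tau (h t : ℝ) : ℝ :=
  if h = 0 then t else (Real.exp (-h * t) - 1) / (-h)

/-- The function `X¹(t) = (γ τ + δ)⁻¹`, where `τ = (e^{-ht} - 1)/(-h)` or `τ = t`. -/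
noncomputable def X1 (h γ δ t : ℝ) : ℝ := (γ * tau h t + δ)⁻¹

end Burgers

namespace Burgers

/-! Both directions go through one normal form: `t' = T(t)`, `x' = A x + B`, `u' = P u + Q x + R`,
`g' = A P g`, with coefficients depending on `t` and `h` only and solving a first-order ODE system
in `t`, the `DeterminingSystem`.

Sufficiency. If the system holds, differentiating `v(T, A x + B) = P u + Q x + R` shows that `T'`
times the residual of the new equation equals `P` times the residual of the old one
(`mapsEquation_of_determiningSystem`). The stated formulas solve the system
(`determiningSystem_coeff`). The new `g'` is a function of the new time because a Möbius map between
`τ_h(t)` and `τ_{h'}(T)` can be inverted.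

Necessity. Through any point of the domain pass an affine `g` of arbitrary slope `c` and a quadratic
`u` with arbitrary `u_t`, `u_x`, `u_tt`, `u_xx`; the equivalence of the two equations becomes an
algebraic relation between jets (`exists_jet_relation`), which is split with respect to the free
quantities. Since `u_tt` is absent from the equation, `T_x = T_u = 0` (`fderiv_newT_xu`); since `c`
is arbitrary and the Jacobian never vanishes, `T_g = 0` (`fderiv_newT_g`). The coefficient of `u_xx`
gives `g (X_x + u_x X_u)² = T_t g'`, hence `X_u = 0` and `X_xx = 0`. Splitting the rest in `c`, `g`
and `u_x` removes the dependence of `X` and `U` on `g` and leaves `T_t U = X_x u + X_t` together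
with one linear equation for `U` (`newU_equations`). So everything is affine in `x`, `u`, and the
system follows (`exists_determiningSystem`).

The system has enough first integrals to be solved explicitly
(`DeterminingSystem.exists_constants`); the integration constants are `α, β, γ, δ, μ₀, μ₁`, one set
for each `h`. They are determined by `Φ`, so their smoothness in `h` is recovered afterwards from
values of `Φ` at two times and two positions (`exists_parameterFamily`). -/

theorem det_ne_zero_iff_injective {E : Type*} [NormedAddCommGroup E] [NormedSpace ℝ E]
    [FiniteDimensional ℝ E] (A : E →L[ℝ] E) : A.det ≠ 0 ↔ ∀ v, A v = 0 → v = 0 := by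
  have h : A.det = LinearMap.det (A : E →ₗ[ℝ] E) := rfl
  rw [h, ← isUnit_iff_ne_zero, ← LinearMap.isUnit_iff_isUnit_det, LinearMap.isUnit_iff_ker_eq_bot,
    LinearMap.ker_eq_bot']
  rfl

theorem surjective_of_det_ne_zero {E : Type*} [NormedAddCommGroup E] [NormedSpace ℝ E]
    [FiniteDimensional ℝ E] (A : E →L[ℝ] E) (h : A.det ≠ 0) : Function.Surjective A := by
  have h1 := (det_ne_zero_iff_injective A).1 h
  have h2 : Function.Injective (A : E →ₗ[ℝ] E) := by
    rw [← LinearMap.ker_eq_bot, LinearMap.ker_eq_bot']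
    exact h1
  exact LinearMap.surjective_of_injective h2

/-! ### The function `τ_h` and its inverse, jointly smooth across `h = 0`. -/

/-- Away from `a` this is a quotient with nonzero denominator; at `a` the power series of `f` is
shifted by one. It removes the apparent singularity at `h = 0` in `tau` and `tauInv`. -/
theorem analyticAt_dslope {f : ℝ → ℝ} {a z : ℝ} (ha : AnalyticAt ℝ f a) (hz : AnalyticAt ℝ f z) :
    AnalyticAt ℝ (dslope f a) z := by
  by_cases h : z = a
  · subst h
    obtain ⟨p, hp⟩ := ha
    exact ⟨_, hp.has_fpower_series_dslope_fslope⟩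
  · have : AnalyticAt ℝ (fun y => (y - a)⁻¹ * (f y - f a)) z :=
      ((analyticAt_id.sub analyticAt_const).inv (sub_ne_zero.2 h)).mul (hz.sub analyticAt_const)
    refine this.congr ?_
    filter_upwards [isOpen_ne.mem_nhds h] with y hy
    rw [dslope_of_ne _ hy, slope_def_module]; rfl

theorem tau_eq_dslope (h t : ℝ) : tau h t = t * dslope Real.exp 0 (-h * t) := by
  unfold tau
  split_ifs with h0
  · simp [h0, dslope_same]
  · by_cases ht : t = 0
    · simp [ht]
    · rw [dslope_of_ne _ (by simp [h0, ht]), slope_def_field, Real.exp_zero]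
      field_simp
      ring

theorem contDiff_tau : ContDiff ℝ ∞ (fun p : ℝ × ℝ => tau p.1 p.2) := by
  simp_rw [tau_eq_dslope]
  have : ContDiff ℝ ∞ (dslope Real.exp 0) := contDiff_iff_contDiffAt.2 fun z =>
    (analyticAt_dslope analyticAt_rexp analyticAt_rexp).contDiffAt
  fun_prop

theorem hasDerivAt_tau (h t : ℝ) : HasDerivAt (tau h) (Real.exp (-h * t)) t := by
  unfold tau
  split_ifs with h0
  · simpa [h0] using hasDerivAt_id' t
  · have h1 := ((((hasDerivAt_id t).const_mul (-h)).exp).sub_const 1).div_const (-h)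
    refine h1.congr_deriv ?_
    simp only [id]
    field_simp

/-- This form is uniform in `h`, zero included; it shows that `τ_h` takes values only where `h y <
1`, the domain on which `tauInv` is smooth. -/
theorem one_sub_mul_tau (h t : ℝ) : 1 - h * tau h t = Real.exp (-h * t) := by
  unfold tau
  split_ifs with h0
  · simp [h0]
  · field_simp
    ring

/-- The inverse function of `tau h`, in a form that is smooth in both arguments. -/
noncomputable def tauInv (h y : ℝ) : ℝ := y * dslope (fun z => -Real.log (1 - z)) 0 (h * y)

theorem tauInv_tau (h t : ℝ) : tauInv h (tau h t) = t := by
  unfold tauInv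
  by_cases h0 : h = 0
  · have hd : HasDerivAt (fun z : ℝ => -Real.log (1 - z)) 1 0 := by
      have := ((hasDerivAt_id' (0 : ℝ)).const_sub 1).log (by norm_num)
      exact this.fun_neg.congr_deriv (by norm_num)
    simp [h0, dslope_same, hd.deriv, tau]
  · by_cases hy : tau h t = 0
    · have := one_sub_mul_tau h t
      rw [hy, mul_zero, sub_zero, eq_comm, Real.exp_eq_one_iff] at this
      have ht : t = 0 := by simpa [h0] using this
      rw [hy, ht, zero_mul]
    · rw [dslope_of_ne _ (mul_ne_zero h0 hy), slope_def_field, one_sub_mul_tau, Real.log_exp]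
      simp
      field_simp

theorem contDiffAt_tauInv {h y : ℝ} (hy : h * y < 1) :
    ContDiffAt ℝ ∞ (fun p : ℝ × ℝ => tauInv p.1 p.2) (h, y) := by
  have han : ∀ z : ℝ, z < 1 → AnalyticAt ℝ (fun z : ℝ => -Real.log (1 - z)) z := fun z hz =>
    ((analyticAt_const.sub analyticAt_id).log (by simpa using hz)).neg
  have hl : ContDiffAt ℝ ∞ (dslope (fun z => -Real.log (1 - z)) 0) (h * y) :=
    (analyticAt_dslope (han 0 one_pos) (han _ hy)).contDiffAt
  unfold tauInv
  refine contDiffAt_snd.mul ?_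
  exact ContDiffAt.comp (h, y) (g := dslope (fun z => -Real.log (1 - z)) 0)
    (f := fun p : ℝ × ℝ => p.1 * p.2) hl (by fun_prop)

theorem mul_tau_lt_one (h t : ℝ) : h * tau h t < 1 := by
  have := one_sub_mul_tau h t
  have := Real.exp_pos (-h * t)
  linarith

theorem tau_injective (h : ℝ) : Function.Injective (tau h) := fun a b hab => by
  rw [← tauInv_tau h a, hab, tauInv_tau]

/-! ### Derivatives along curves and the operators `dt`, `dx`. -/

/-- First and second derivative of a function along a curve. -/
theorem hasDerivAt_comp_curve {E F : Type*} [NormedAddCommGroup E] [NormedSpace ℝ E]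
    [NormedAddCommGroup F] [NormedSpace ℝ F] {f : E → F} {w w' : ℝ → E} {w'' : E} {s₀ : ℝ}
    (hf : ContDiffAt ℝ ∞ f (w s₀)) (hw : ∀ᶠ s in 𝓝 s₀, HasDerivAt w (w' s) s)
    (hw' : HasDerivAt w' w'' s₀) :
    (∀ᶠ s in 𝓝 s₀, HasDerivAt (fun s => f (w s)) (fderiv ℝ f (w s) (w' s)) s) ∧
    HasDerivAt (fun s => fderiv ℝ f (w s) (w' s))
      (fderiv ℝ (fderiv ℝ f) (w s₀) (w' s₀) (w' s₀) + fderiv ℝ f (w s₀) w'') s₀ := by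
  have hc : ContinuousAt w s₀ := hw.self_of_nhds.continuousAt
  constructor
  · have h1 : ∀ᶠ y in 𝓝 (w s₀), ContDiffAt ℝ 1 f y :=
      (hf.of_le (by exact_mod_cast le_top : (1 : WithTop ℕ∞) ≤ ∞)).eventually (by simp)
    filter_upwards [hc.eventually h1, hw] with s hs hs'
    exact (hs.differentiableAt one_ne_zero).hasFDerivAt.comp_hasDerivAt s hs'
  · have h2 : DifferentiableAt ℝ (fderiv ℝ f) (w s₀) :=
      (hf.fderiv_right (m := 1) (by norm_cast)).differentiableAt one_ne_zero
    have h3 := h2.hasFDerivAt.comp_hasDerivAt s₀ hw.self_of_nhds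
    exact h3.clm_apply hw'

theorem hasDerivAt_horizontal (z : ℝ × ℝ) (s : ℝ) :
    HasDerivAt (fun s : ℝ => ((s, z.2) : ℝ × ℝ)) (1, 0) s :=
  (hasDerivAt_id' s).prodMk (hasDerivAt_const s z.2)

theorem hasDerivAt_vertical (z : ℝ × ℝ) (s : ℝ) :
    HasDerivAt (fun s : ℝ => ((z.1, s) : ℝ × ℝ)) (0, 1) s :=
  (hasDerivAt_const s z.1).prodMk (hasDerivAt_id' s)

theorem dt_eq_fderiv {v : ℝ × ℝ → ℝ} {z : ℝ × ℝ} (hv : DifferentiableAt ℝ v z) :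
    dt v z = fderiv ℝ v z (1, 0) :=
  HasDerivAt.deriv (hv.hasFDerivAt.comp_hasDerivAt z.1 (hasDerivAt_horizontal z z.1))

theorem dx_eq_fderiv {v : ℝ × ℝ → ℝ} {z : ℝ × ℝ} (hv : DifferentiableAt ℝ v z) :
    dx v z = fderiv ℝ v z (0, 1) :=
  HasDerivAt.deriv (hv.hasFDerivAt.comp_hasDerivAt z.2 (hasDerivAt_vertical z z.2))

theorem eventually_differentiableAt {E F : Type*} [NormedAddCommGroup E] [NormedSpace ℝ E]
    [NormedAddCommGroup F] [NormedSpace ℝ F] {f : E → F} {z : E} (hf : ContDiffAt ℝ ∞ f z) :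
    ∀ᶠ y in 𝓝 z, DifferentiableAt ℝ f y := by
  have h1 : ∀ᶠ y in 𝓝 z, ContDiffAt ℝ 1 f y :=
    (hf.of_le (by exact_mod_cast le_top : (1 : WithTop ℕ∞) ≤ ∞)).eventually (by simp)
  exact h1.mono fun y hy => hy.differentiableAt one_ne_zero

theorem dx_dx_eq_fderiv {v : ℝ × ℝ → ℝ} {z : ℝ × ℝ} (hv : ContDiffAt ℝ ∞ v z) :
    dx (dx v) z = fderiv ℝ (fderiv ℝ v) z (0, 1) (0, 1) := by
  have h2 := (hasDerivAt_comp_curve (f := v) (w := fun s => (z.1, s)) (w' := fun _ => (0, 1))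
    (w'' := 0) (s₀ := z.2) hv (Eventually.of_forall fun s => hasDerivAt_vertical z s)
    (hasDerivAt_const _ _)).2
  rw [map_zero, add_zero] at h2
  have hc : ContinuousAt (fun s : ℝ => ((z.1, s) : ℝ × ℝ)) z.2 :=
    (hasDerivAt_vertical z z.2).continuousAt
  refine (h2.congr_of_eventuallyEq ?_).deriv
  filter_upwards [hc.eventually (eventually_differentiableAt hv)] with s hs
  exact dx_eq_fderiv hs

/-! ### Sufficiency: solutions of the determining system map equations to equations. -/

/-- The differential equations in `t` which characterize the point transformations
`t' = T`, `x' = A x + B`, `u' = P u + Q x + R` between two equations of the class with constants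
`h` and `h'`. -/
structure DeterminingSystem (h h' : ℝ) (T T' A B P Q R : ℝ → ℝ) (t : ℝ) : Prop where
  T'_ne : T' t ≠ 0
  A_ne : A t ≠ 0
  A_eq : A t = P t * T' t
  derivT : HasDerivAt T (T' t) t
  derivA : HasDerivAt A (Q t * T' t) t
  derivB : HasDerivAt B (R t * T' t) t
  derivP : HasDerivAt P (h * P t - Q t - h' * A t) t
  derivQ : HasDerivAt Q (-h' * (Q t * T' t)) t
  derivR : HasDerivAt R (-h' * (R t * T' t)) t

/-- The relation between `u` and `v` is differentiated once in `t` and twice in `x`. With the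
determining system, the two residuals become proportional with nonvanishing factors, so they vanish
together. -/
theorem mapsEquation_of_determiningSystem {φ : BasePt → BasePt} {D : Set BasePt} (hD : IsOpen D)
    {h h' : ℝ} {g g' T T' A B P Q R : ℝ → ℝ}
    (hφ : ∀ p ∈ D, φ p = (T p.1, A p.1 * p.2.1 + B p.1, P p.1 * p.2.2 + Q p.1 * p.2.1 + R p.1))
    (hS : ∀ p ∈ D, DeterminingSystem h h' T T' A B P Q R p.1)
    (hg : ∀ p ∈ D, g' (T p.1) = A p.1 * P p.1 * g p.1) :
    MapsEquation φ D h g h' g' := by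
  intro u v z hz hu _ hv hev
  obtain ⟨z1, z2⟩ := z
  simp only at hz
  have hY : baseAlong φ u (z1, z2) = (T z1, A z1 * z2 + B z1) := by
    simp only [baseAlong, hφ _ hz]
  have S := hS _ hz
  have hgz := hg _ hz
  simp only at S hgz
  rw [hY] at hv ⊢
  have hcont : ContinuousAt (fun w : ℝ × ℝ => ((w.1, w.2, u w) : BasePt)) (z1, z2) :=
    continuousAt_fst.prodMk (continuousAt_snd.prodMk hu.continuousAt)
  have hev' : ∀ᶠ w in 𝓝 ((z1, z2) : ℝ × ℝ), v (T w.1, A w.1 * w.2 + B w.1)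
      = P w.1 * u w + Q w.1 * w.2 + R w.1 := by
    filter_upwards [hev, hcont.eventually (hD.mem_nhds hz)] with w hw hwD
    simpa only [baseAlong, valueAlong, hφ _ hwD] using hw
  have hud : DifferentiableAt ℝ u (z1, z2) := hu.differentiableAt (by simp)
  have hvd : DifferentiableAt ℝ v (T z1, A z1 * z2 + B z1) := hv.differentiableAt (by simp)
  -- the derivative along `t`
  have ht : HasDerivAt (fun s : ℝ => ((T s, A s * z2 + B s) : ℝ × ℝ))
      (T' z1, Q z1 * T' z1 * z2 + R z1 * T' z1) z1 :=
    S.derivT.prodMk ((S.derivA.mul_const z2).add S.derivB)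
  have h1 := hvd.hasFDerivAt.comp_hasDerivAt z1 ht
  have h2 : HasDerivAt (fun s => P s * u (s, z2) + Q s * z2 + R s) _ z1 :=
    ((S.derivP.mul (hud.hasFDerivAt.comp_hasDerivAt z1 (hasDerivAt_horizontal (z1, z2) z1))).add
      (S.derivQ.mul_const z2)).add S.derivR
  have e1 := h1.unique (h2.congr_of_eventuallyEq
    ((hasDerivAt_horizontal (z1, z2) z1).continuousAt.eventually hev'))
  -- the derivatives along `x`
  have hx : ∀ s : ℝ, HasDerivAt (fun s : ℝ => ((T z1, A z1 * s + B z1) : ℝ × ℝ)) (0, A z1) s :=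
    fun s => by
      have := (hasDerivAt_const s (T z1)).prodMk
        (((hasDerivAt_id' s).const_mul (A z1)).add_const (B z1))
      simpa using this
  obtain ⟨h3, h4⟩ := hasDerivAt_comp_curve (s₀ := z2) (w' := fun _ => (0, A z1)) hv
    (Eventually.of_forall hx) (hasDerivAt_const _ _)
  obtain ⟨h5, h6⟩ := hasDerivAt_comp_curve (s₀ := z2) (f := u) (w' := fun _ => (0, 1)) hu
    (Eventually.of_forall (hasDerivAt_vertical (z1, z2))) (hasDerivAt_const _ _)
  have hevx := (hasDerivAt_vertical (z1, z2) z2).continuousAt.eventually hev'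
  have e2 : ∀ᶠ s in 𝓝 z2, fderiv ℝ v (T z1, A z1 * s + B z1) (0, A z1)
      = P z1 * fderiv ℝ u (z1, s) (0, 1) + Q z1 := by
    filter_upwards [h3, h5, hevx.eventually_nhds] with s hs hs' hss
    have := ((hs'.const_mul (P z1)).add ((hasDerivAt_id' s).const_mul (Q z1))).add_const (R z1)
    rw [hs.unique (this.congr_of_eventuallyEq hss), mul_one]
  have e3 := h4.unique (((h6.const_mul (P z1)).add_const (Q z1)).congr_of_eventuallyEq e2)
  have e2 := e2.self_of_nhds
  unfold SatisfiesAt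
  rw [dt_eq_fderiv hud, dx_eq_fderiv hud, dx_dx_eq_fderiv hu, dt_eq_fderiv hvd, dx_eq_fderiv hvd,
    dx_dx_eq_fderiv hv, hev'.self_of_nhds]
  simp only [map_zero, add_zero] at e3
  have r1 : ∀ a b : ℝ, ((a, b) : ℝ × ℝ) = a • (1, 0) + b • (0, 1) := fun a b => by simp
  rw [r1 (T' z1)] at e1
  rw [r1 0 (A z1)] at e2 e3
  simp only [map_add, map_smul, zero_smul, zero_add, smul_eq_mul, Function.comp_apply,
    smul_apply] at e1 e2 e3
  simp only [hgz]
  have hPne : P z1 ≠ 0 := fun h0 => S.A_ne (by rw [S.A_eq, h0, zero_mul])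
  have hA := S.A_eq
  generalize fderiv ℝ v (T z1, A z1 * z2 + B z1) (1, 0) = vt at *
  generalize fderiv ℝ v (T z1, A z1 * z2 + B z1) (0, 1) = vx at *
  generalize fderiv ℝ (fderiv ℝ v) (T z1, A z1 * z2 + B z1) (0, 1) (0, 1) = vxx at *
  generalize fderiv ℝ u (z1, z2) (1, 0) = ut at *
  generalize fderiv ℝ u (z1, z2) (0, 1) = ux at *
  generalize fderiv ℝ (fderiv ℝ u) (z1, z2) (0, 1) (0, 1) = uxx at *
  -- The combination `∂_t + u ∂_x - g ∂_x²` of the differentiated relations; the remaining terms in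
  -- `u` and `v_xx` are matched by `A = P T'`.
  have key : T' z1 * (vt + (P z1 * u (z1, z2) + Q z1 * z2 + R z1) * vx
      + h' * (P z1 * u (z1, z2) + Q z1 * z2 + R z1) - A z1 * P z1 * g z1 * vxx)
      = P z1 * (ut + u (z1, z2) * ux + h * u (z1, z2) - g z1 * uxx) := by
    linear_combination e1 + u (z1, z2) * e2 - g z1 * e3
      + (-u (z1, z2) * vx - h' * u (z1, z2) + A z1 * g z1 * vxx) * hA
  constructor
  · intro hh
    have : T' z1 * _ = T' z1 * 0 := key.trans (by rw [hh]; ring)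
    exact sub_eq_zero.1 (mul_left_cancel₀ S.T'_ne this)
  · intro hh
    have : P z1 * _ = P z1 * 0 := key.symm.trans (by rw [hh]; ring)
    exact sub_eq_zero.1 (mul_left_cancel₀ hPne this)

/-! ### Sufficiency: the explicit coefficients solve the determining system. -/

/-- The new time: the solution `T` of `τ_{h'}(T) = (α τ_h(t) + β) / (γ τ_h(t) + δ)`. -/
noncomputable def newTime (h h' α β γ δ t : ℝ) : ℝ :=
  tauInv h' ((α * tau h t + β) / (γ * tau h t + δ))

/-- The coefficient of `x` in the new `x`. -/
noncomputable def coeffA (h γ δ t : ℝ) : ℝ := (γ * tau h t + δ)⁻¹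

/-- The free term in the new `x`. -/
noncomputable def coeffB (h γ δ μ₀ μ₁ t : ℝ) : ℝ := (μ₁ * tau h t + μ₀) * (γ * tau h t + δ)⁻¹

/-- The coefficient of `u` in the new `u`. -/
noncomputable def coeffP (h h' α β γ δ t : ℝ) : ℝ :=
  Real.exp (h * t - h' * newTime h h' α β γ δ t) * (γ * tau h t + δ) / (α * δ - β * γ)

/-- The coefficient of `x` in the new `u`. -/
noncomputable def coeffQ (h h' α β γ δ t : ℝ) : ℝ :=
  -γ * Real.exp (-h' * newTime h h' α β γ δ t) / (α * δ - β * γ)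

/-- The free term in the new `u`. -/
noncomputable def coeffR (h h' α β γ δ μ₀ μ₁ t : ℝ) : ℝ :=
  (μ₁ * δ - γ * μ₀) * Real.exp (-h' * newTime h h' α β γ δ t) / (α * δ - β * γ)

theorem hasDerivAt_newTime {h h' α β γ δ t : ℝ} (hN : γ * tau h t + δ ≠ 0)
    (hT : ∀ᶠ s in 𝓝 t, tau h' (newTime h h' α β γ δ s) = (α * tau h s + β) / (γ * tau h s + δ)) :
    HasDerivAt (newTime h h' α β γ δ)
      ((α * δ - β * γ) * Real.exp (h' * newTime h h' α β γ δ t - h * t) / (γ * tau h t + δ) ^ 2)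
      t := by
  have hτ := hasDerivAt_tau h t
  have hρ : HasDerivAt (fun s => (α * tau h s + β) / (γ * tau h s + δ))
      ((α * δ - β * γ) * Real.exp (-h * t) / (γ * tau h t + δ) ^ 2) t := by
    refine (((hτ.const_mul α).add_const β).fun_div ((hτ.const_mul γ).add_const δ) hN).congr_deriv ?_
    ring
  have hlt : h' * ((α * tau h t + β) / (γ * tau h t + δ)) < 1 := by
    rw [← hT.self_of_nhds]; exact mul_tau_lt_one _ _
  -- The explicit inverse serves only to give differentiability; the value of the derivative comes
  -- from differentiating the implicit relation `hT`.
  have hd : DifferentiableAt ℝ (newTime h h' α β γ δ) t := by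
    have h1 : DifferentiableAt ℝ (fun p : ℝ × ℝ => tauInv p.1 p.2)
      (h', (α * tau h t + β) / (γ * tau h t + δ)) := (contDiffAt_tauInv hlt).differentiableAt (by simp)
    exact DifferentiableAt.comp t (f := fun s => (h', (α * tau h s + β) / (γ * tau h s + δ))) h1
      ((differentiableAt_const _).prodMk hρ.differentiableAt)
  have h1 := (hasDerivAt_tau h' (newTime h h' α β γ δ t)).comp t hd.hasDerivAt
  have h2 := h1.unique (hρ.congr_of_eventuallyEq hT)
  refine hd.hasDerivAt.congr_deriv ?_
  have h3 : deriv (newTime h h' α β γ δ) t = Real.exp (h' * newTime h h' α β γ δ t) *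
      (Real.exp (-h' * newTime h h' α β γ δ t) * deriv (newTime h h' α β γ δ) t) := by
    rw [← mul_assoc, ← Real.exp_add]; simp
  rw [h3, h2, Real.exp_sub, neg_mul, Real.exp_neg]
  ring

theorem determiningSystem_coeff {h h' α β γ δ μ₀ μ₁ t : ℝ} (hΔ : α * δ - β * γ ≠ 0)
    (hN : γ * tau h t + δ ≠ 0)
    (hT : ∀ᶠ s in 𝓝 t, tau h' (newTime h h' α β γ δ s) = (α * tau h s + β) / (γ * tau h s + δ)) :
    DeterminingSystem h h' (newTime h h' α β γ δ)
      (fun t => (α * δ - β * γ) * Real.exp (h' * newTime h h' α β γ δ t - h * t) /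
        (γ * tau h t + δ) ^ 2)
      (coeffA h γ δ) (coeffB h γ δ μ₀ μ₁) (coeffP h h' α β γ δ) (coeffQ h h' α β γ δ)
      (coeffR h h' α β γ δ μ₀ μ₁) t := by
  have hdT := hasDerivAt_newTime hN hT
  have hτ := hasDerivAt_tau h t
  have hNd := (hτ.const_mul γ).add_const δ
  have hE := Real.exp_ne_zero (h' * newTime h h' α β γ δ t)
  have hW := Real.exp_ne_zero (h * t)
  have hdE := (hdT.const_mul (-h')).exp
  refine ⟨div_ne_zero (mul_ne_zero hΔ (Real.exp_ne_zero _)) (pow_ne_zero 2 hN), inv_ne_zero hN, ?_,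
    hdT, (hNd.fun_inv hN).congr_deriv ?_,
    (((hτ.const_mul μ₁).add_const μ₀).mul (hNd.fun_inv hN)).congr_deriv ?_,
    (((((hasDerivAt_id' t).const_mul h).sub (hdT.const_mul h')).exp.mul hNd).div_const
      (α * δ - β * γ)).congr_deriv ?_,
    ((hdE.const_mul (-γ)).div_const (α * δ - β * γ)).congr_deriv ?_,
    ((hdE.const_mul (μ₁ * δ - γ * μ₀)).div_const (α * δ - β * γ)).congr_deriv ?_⟩ <;>
  -- With the two exponentials and `τ` treated as independent symbols, all the conditions are
  -- rational identities.
  · simp only [coeffA, coeffP, coeffQ, coeffR, neg_mul, Real.exp_neg, Real.exp_sub, Pi.sub_apply]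
    generalize Real.exp (h' * newTime h h' α β γ δ t) = E at *
    generalize Real.exp (h * t) = W at *
    generalize tau h t = τ at *
    generalize hD : α * δ - β * γ = d at *
    field_simp
    try ring

/-! ### Sufficiency: the normal form, its smoothness and its Jacobian. -/

/-- Parameters of a generalized equivalence transformation: smooth functions of `h` with
`H' ≠ 0` and `α δ - β γ ≠ 0` for which the new time is defined on `I`. -/
structure IsParameterFamily (I L : Set ℝ) (H α β γ δ μ₀ μ₁ : ℝ → ℝ) : Prop where
  smoothH : ContDiffOn ℝ ∞ H L
  smoothα : ContDiffOn ℝ ∞ α L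
  smoothβ : ContDiffOn ℝ ∞ β L
  smoothγ : ContDiffOn ℝ ∞ γ L
  smoothδ : ContDiffOn ℝ ∞ δ L
  smoothμ₀ : ContDiffOn ℝ ∞ μ₀ L
  smoothμ₁ : ContDiffOn ℝ ∞ μ₁ L
  derivH : ∀ h ∈ L, deriv H h ≠ 0
  det_ne : ∀ h ∈ L, α h * δ h - β h * γ h ≠ 0
  denom_ne : ∀ h ∈ L, ∀ t ∈ I, γ h * tau h t + δ h ≠ 0
  range : ∀ h ∈ L, ∀ t ∈ I, ∃ T, tau (H h) T = (α h * tau h t + β h) / (γ h * tau h t + δ h)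

theorem eq_newTime {h h' α β γ δ t T : ℝ}
    (hT : tau h' T = (α * tau h t + β) / (γ * tau h t + δ)) : T = newTime h h' α β γ δ t := by
  rw [newTime, ← hT, tauInv_tau]

/-- The transformation with given parameters, written out as a polynomial in `x`, `u` and `g`. -/
noncomputable def normalForm (H α β γ δ μ₀ μ₁ : ℝ → ℝ) (q : ExtPt) : ExtPt :=
  (newTime q.2.2.2.1 (H q.2.2.2.1) (α q.2.2.2.1) (β q.2.2.2.1) (γ q.2.2.2.1) (δ q.2.2.2.1) q.1,
   coeffA q.2.2.2.1 (γ q.2.2.2.1) (δ q.2.2.2.1) q.1 * q.2.1 +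
    coeffB q.2.2.2.1 (γ q.2.2.2.1) (δ q.2.2.2.1) (μ₀ q.2.2.2.1) (μ₁ q.2.2.2.1) q.1,
   coeffP q.2.2.2.1 (H q.2.2.2.1) (α q.2.2.2.1) (β q.2.2.2.1) (γ q.2.2.2.1) (δ q.2.2.2.1) q.1
      * q.2.2.1 +
    coeffQ q.2.2.2.1 (H q.2.2.2.1) (α q.2.2.2.1) (β q.2.2.2.1) (γ q.2.2.2.1) (δ q.2.2.2.1) q.1
      * q.2.1 +
    coeffR q.2.2.2.1 (H q.2.2.2.1) (α q.2.2.2.1) (β q.2.2.2.1) (γ q.2.2.2.1) (δ q.2.2.2.1)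
      (μ₀ q.2.2.2.1) (μ₁ q.2.2.2.1) q.1,
   H q.2.2.2.1,
   coeffA q.2.2.2.1 (γ q.2.2.2.1) (δ q.2.2.2.1) q.1 *
    coeffP q.2.2.2.1 (H q.2.2.2.1) (α q.2.2.2.1) (β q.2.2.2.1) (γ q.2.2.2.1) (δ q.2.2.2.1) q.1
      * q.2.2.2.2)

theorem deriv_X1 {h γ δ t : ℝ} (hN : γ * tau h t + δ ≠ 0) :
    deriv (X1 h γ δ) t = -(γ * Real.exp (-h * t)) / (γ * tau h t + δ) ^ 2 :=
  ((((hasDerivAt_tau h t).const_mul γ).add_const δ).fun_inv hN).deriv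

/-- Here `X¹_t / X¹ = -γ e^{-ht} / (γτ + δ)`, so the terms with `τ` cancel in `(μ₁τ + μ₀) X¹_t / X¹
+ μ₁ e^{-ht}`; this leaves the constant `μ₁δ - γμ₀` of `coeffR`. -/
theorem formula_eq_normalForm {H α β γ δ μ₀ μ₁ : ℝ → ℝ} {t x u h g T : ℝ}
    (hΔ : α h * δ h - β h * γ h ≠ 0) (hN : γ h * tau h t + δ h ≠ 0)
    (hT : tau (H h) T = (α h * tau h t + β h) / (γ h * tau h t + δ h)) :
    ((T,
      (x + μ₁ h * tau h t + μ₀ h) * X1 h (γ h) (δ h) t,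
      Real.exp (h * t - H h * T) / ((α h * δ h - β h * γ h) * X1 h (γ h) (δ h) t) *
        (u + (x + μ₁ h * tau h t + μ₀ h) *
            (deriv (X1 h (γ h) (δ h)) t / X1 h (γ h) (δ h) t)
          + μ₁ h * Real.exp (-h * t)),
      H h,
      Real.exp (h * t - H h * T) / (α h * δ h - β h * γ h) * g) : ExtPt) =
    normalForm H α β γ δ μ₀ μ₁ (t, x, u, h, g) := by
  rw [deriv_X1 hN]
  unfold normalForm coeffA coeffB coeffP coeffQ coeffR
  simp only
  rw [← eq_newTime hT]
  unfold X1
  simp only [neg_mul, Real.exp_neg, Real.exp_sub]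
  have hE := Real.exp_ne_zero (H h * T)
  have hW := Real.exp_ne_zero (h * t)
  generalize Real.exp (H h * T) = E at *
  generalize Real.exp (h * t) = W at *
  generalize tau h t = τ at *
  generalize hD : α h * δ h - β h * γ h = d at *
  refine Prod.ext rfl (Prod.ext ?_ (Prod.ext ?_ (Prod.ext rfl ?_))) <;> simp only <;>
    field_simp <;> try ring

theorem isOpen_box {I J K L M : Set ℝ} (hI : IsOpen I) (hJ : IsOpen J) (hK : IsOpen K)
    (hL : IsOpen L) (hM : IsOpen M) : IsOpen (I ×ˢ J ×ˢ K ×ˢ L ×ˢ M) :=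
  hI.prod (hJ.prod (hK.prod (hL.prod hM)))

namespace IsParameterFamily

variable {I L : Set ℝ} {H α β γ δ μ₀ μ₁ : ℝ → ℝ}

theorem tau_newTime (F : IsParameterFamily I L H α β γ δ μ₀ μ₁) {h t : ℝ} (hh : h ∈ L)
    (ht : t ∈ I) : tau (H h) (newTime h (H h) (α h) (β h) (γ h) (δ h) t) =
      (α h * tau h t + β h) / (γ h * tau h t + δ h) := by
  obtain ⟨T, hT⟩ := F.range h hh t ht
  rw [← eq_newTime hT, hT]

theorem determiningSystem (F : IsParameterFamily I L H α β γ δ μ₀ μ₁) (hI : IsOpen I) {h t : ℝ}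
    (hh : h ∈ L) (ht : t ∈ I) :
    DeterminingSystem h (H h) (newTime h (H h) (α h) (β h) (γ h) (δ h))
      (fun t => (α h * δ h - β h * γ h) *
        Real.exp (H h * newTime h (H h) (α h) (β h) (γ h) (δ h) t - h * t) /
        (γ h * tau h t + δ h) ^ 2)
      (coeffA h (γ h) (δ h)) (coeffB h (γ h) (δ h) (μ₀ h) (μ₁ h))
      (coeffP h (H h) (α h) (β h) (γ h) (δ h)) (coeffQ h (H h) (α h) (β h) (γ h) (δ h))
      (coeffR h (H h) (α h) (β h) (γ h) (δ h) (μ₀ h) (μ₁ h)) t :=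
  determiningSystem_coeff (F.det_ne h hh) (F.denom_ne h hh t ht) <| by
    filter_upwards [hI.mem_nhds ht] with s hs using F.tau_newTime hh hs

theorem contDiffAt_normalForm (F : IsParameterFamily I L H α β γ δ μ₀ μ₁) (hL : IsOpen L)
    {q : ExtPt} (ht : q.1 ∈ I) (hh : q.2.2.2.1 ∈ L) :
    ContDiffAt ℝ ∞ (normalForm H α β γ δ μ₀ μ₁) q := by
  obtain ⟨t, x, u, h, g⟩ := q
  simp only at ht hh
  have hL' := hL.mem_nhds hh
  have aux : ∀ {f : ℝ → ℝ}, ContDiffOn ℝ ∞ f L →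
      ContDiffAt ℝ ∞ (fun q : ExtPt => f q.2.2.2.1) (t, x, u, h, g) := fun {f} hf =>
    ContDiffAt.comp (t, x, u, h, g) (g := f) (f := fun q : ExtPt => q.2.2.2.1)
      (hf.contDiffAt hL') (by fun_prop)
  have sH := aux F.smoothH
  have sα := aux F.smoothα
  have sβ := aux F.smoothβ
  have sγ := aux F.smoothγ
  have sδ := aux F.smoothδ
  have sμ₀ := aux F.smoothμ₀
  have sμ₁ := aux F.smoothμ₁
  have sτ : ContDiffAt ℝ ∞ (fun q : ExtPt => tau q.2.2.2.1 q.1) (t, x, u, h, g) :=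
    contDiff_tau.contDiffAt.comp (t, x, u, h, g) (f := fun q : ExtPt => (q.2.2.2.1, q.1))
      (by fun_prop)
  have hN := F.denom_ne h hh t ht
  have hΔ := F.det_ne h hh
  have sN := (sγ.mul sτ).add sδ
  have sN' := sN.inv hN
  have sΔ := (sα.mul sδ).sub (sβ.mul sγ)
  have sT : ContDiffAt ℝ ∞ (fun q : ExtPt => newTime q.2.2.2.1 (H q.2.2.2.1) (α q.2.2.2.1)
      (β q.2.2.2.1) (γ q.2.2.2.1) (δ q.2.2.2.1) q.1) (t, x, u, h, g) := by
    have h1 : ContDiffAt ℝ ∞ (fun p : ℝ × ℝ => tauInv p.1 p.2)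
        (H h, (α h * tau h t + β h) / (γ h * tau h t + δ h)) := by
      refine contDiffAt_tauInv ?_
      rw [← F.tau_newTime hh ht]
      exact mul_tau_lt_one _ _
    exact ContDiffAt.comp (t, x, u, h, g) (f := fun q : ExtPt => (H q.2.2.2.1,
      (α q.2.2.2.1 * tau q.2.2.2.1 q.1 + β q.2.2.2.1) /
        (γ q.2.2.2.1 * tau q.2.2.2.1 q.1 + δ q.2.2.2.1))) h1
      (sH.prodMk (((sα.mul sτ).add sβ).div sN hN))
  have st : ContDiffAt ℝ ∞ (fun q : ExtPt => q.1) (t, x, u, h, g) := by fun_prop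
  have sx : ContDiffAt ℝ ∞ (fun q : ExtPt => q.2.1) (t, x, u, h, g) := by fun_prop
  have su : ContDiffAt ℝ ∞ (fun q : ExtPt => q.2.2.1) (t, x, u, h, g) := by fun_prop
  have sh : ContDiffAt ℝ ∞ (fun q : ExtPt => q.2.2.2.1) (t, x, u, h, g) := by fun_prop
  have sg : ContDiffAt ℝ ∞ (fun q : ExtPt => q.2.2.2.2) (t, x, u, h, g) := by fun_prop
  have sP := ((((sh.mul st).sub (sH.mul sT)).exp).mul sN).div sΔ hΔ
  have sE := (sH.neg.mul sT).exp
  have sQ := (sγ.neg.mul sE).div sΔ hΔ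
  have sR := (((sμ₁.mul sδ).sub (sγ.mul sμ₀)).mul sE).div sΔ hΔ
  have sB := ((sμ₁.mul sτ).add sμ₀).mul sN'
  exact sT.prodMk (((sN'.mul sx).add sB).prodMk ((((sP.mul su).add (sQ.mul sx)).add sR).prodMk
    (sH.prodMk ((sN'.mul sP).mul sg))))

end IsParameterFamily

/-- A derivative along a line which kills the value of the Fréchet derivative vanishes. -/
theorem deriv_line_eq_zero {E F : Type*} [NormedAddCommGroup E] [NormedSpace ℝ E]
    [NormedAddCommGroup F] [NormedSpace ℝ F] {f : E → F} {q v : E} (hf : DifferentiableAt ℝ f q)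
    (hv : fderiv ℝ f q v = 0) (ℓ : F →L[ℝ] ℝ) {d : ℝ}
    (hd : HasDerivAt (fun s : ℝ => ℓ (f (q + s • v))) d 0) : d = 0 := by
  have h1 := (hf.hasFDerivAt.hasLineDerivAt v)
  have h2 : HasDerivAt (fun s : ℝ => ℓ (f (q + s • v))) (ℓ (fderiv ℝ f q v)) 0 :=
    ℓ.hasFDerivAt.comp_hasDerivAt 0 h1
  rw [hd.unique h2, hv, map_zero]

theorem hasDerivAt_line {f : ℝ → ℝ} {f' a : ℝ} (hf : HasDerivAt f f' a) (b : ℝ) :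
    HasDerivAt (fun s : ℝ => f (a + s * b)) (f' * b) 0 := by
  have h1 : HasDerivAt (fun s : ℝ => a + s * b) b 0 := by
    simpa using ((hasDerivAt_id' (0 : ℝ)).mul_const b).const_add a
  exact HasDerivAt.comp (0 : ℝ) (h₂ := f) (by simpa using hf) h1

theorem hasDerivAt_affine_line (c d a b : ℝ) :
    HasDerivAt (fun s : ℝ => c * (a + s * b) + d) (c * b) 0 := by
  have := hasDerivAt_line (((hasDerivAt_id' a).const_mul c).add_const d) b
  simpa using this

/-- The Jacobian matrix is triangular in the order `h, t, x, u, g`, with diagonal `H', T', A, P, A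
P`. A kernel vector is killed one component at a time in that order. -/
theorem fderiv_normalForm_det_ne_zero {I L : Set ℝ} {H α β γ δ μ₀ μ₁ : ℝ → ℝ}
    (F : IsParameterFamily I L H α β γ δ μ₀ μ₁) (hI : IsOpen I) (hL : IsOpen L)
    {q : ExtPt} (ht : q.1 ∈ I) (hh : q.2.2.2.1 ∈ L) :
    (fderiv ℝ (normalForm H α β γ δ μ₀ μ₁) q).det ≠ 0 := by
  rw [det_ne_zero_iff_injective]
  have hd : DifferentiableAt ℝ (normalForm H α β γ δ μ₀ μ₁) q :=
    (F.contDiffAt_normalForm hL ht hh).differentiableAt (by simp)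
  intro v hv
  obtain ⟨t, x, u, h, g⟩ := q
  obtain ⟨v1, v2, v3, v4, v5⟩ := v
  simp only at ht hh
  have S := F.determiningSystem hI hh ht
  have hP : coeffP h (H h) (α h) (β h) (γ h) (δ h) t ≠ 0 := fun h0 =>
    S.A_ne (by rw [S.A_eq, h0, zero_mul])
  have hH : HasDerivAt H (deriv H h) h :=
    ((F.smoothH.contDiffAt (hL.mem_nhds hh)).differentiableAt (by simp)).hasDerivAt
  have h4 : v4 = 0 := by
    have := deriv_line_eq_zero hd hv (.fst ℝ ℝ ℝ ∘L .snd ℝ ℝ (ℝ × ℝ) ∘L .snd ℝ ℝ (ℝ × ℝ × ℝ) ∘L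
      .snd ℝ ℝ (ℝ × ℝ × ℝ × ℝ)) (hasDerivAt_line hH v4)
    exact (mul_eq_zero.1 this).resolve_left (F.derivH h hh)
  subst h4
  have h1 : v1 = 0 := by
    have := deriv_line_eq_zero hd hv (.fst ℝ ℝ (ℝ × ℝ × ℝ × ℝ))
      (d := _ * v1) (by simpa [normalForm] using hasDerivAt_line S.derivT v1)
    exact (mul_eq_zero.1 this).resolve_left S.T'_ne
  subst h1
  have h2 : v2 = 0 := by
    have := deriv_line_eq_zero hd hv (.fst ℝ ℝ (ℝ × ℝ × ℝ) ∘L .snd ℝ ℝ (ℝ × ℝ × ℝ × ℝ))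
      (by
        simpa [normalForm] using hasDerivAt_affine_line (coeffA h (γ h) (δ h) t)
          (coeffB h (γ h) (δ h) (μ₀ h) (μ₁ h) t) x v2)
    exact (mul_eq_zero.1 this).resolve_left S.A_ne
  subst h2
  have h3 : v3 = 0 := by
    have := deriv_line_eq_zero hd hv (.fst ℝ ℝ (ℝ × ℝ) ∘L .snd ℝ ℝ (ℝ × ℝ × ℝ) ∘L
      .snd ℝ ℝ (ℝ × ℝ × ℝ × ℝ))
      (by
        simpa [normalForm, add_assoc] using hasDerivAt_affine_line
          (coeffP h (H h) (α h) (β h) (γ h) (δ h) t)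
          (coeffQ h (H h) (α h) (β h) (γ h) (δ h) t * x +
          coeffR h (H h) (α h) (β h) (γ h) (δ h) (μ₀ h) (μ₁ h) t) u v3)
    exact (mul_eq_zero.1 this).resolve_left hP
  subst h3
  have h5 : v5 = 0 := by
    have := deriv_line_eq_zero hd hv (.snd ℝ ℝ ℝ ∘L .snd ℝ ℝ (ℝ × ℝ) ∘L .snd ℝ ℝ (ℝ × ℝ × ℝ) ∘L
      .snd ℝ ℝ (ℝ × ℝ × ℝ × ℝ))
      (by
        simpa [normalForm] using hasDerivAt_affine_line (coeffA h (γ h) (δ h) t *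
          coeffP h (H h) (α h) (β h) (γ h) (δ h) t) 0 g v5)
    exact (mul_eq_zero.1 this).resolve_left (mul_ne_zero S.A_ne hP)
  subst h5
  rfl

/-- A smooth transformation of the form `(T, A x + B, P u + Q x + R)` with coefficients that solve
the determining system is a point transformation. -/
theorem isPointTransformation_of_determiningSystem {φ : BasePt → BasePt} {D : Set BasePt}
    (hD : IsOpen D) (hsm : ContDiffOn ℝ ∞ φ D) {h h' : ℝ} {T T' A B P Q R : ℝ → ℝ}
    (hφ : ∀ p ∈ D, φ p = (T p.1, A p.1 * p.2.1 + B p.1, P p.1 * p.2.2 + Q p.1 * p.2.1 + R p.1))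
    (hS : ∀ p ∈ D, DeterminingSystem h h' T T' A B P Q R p.1) :
    IsPointTransformation φ D := by
  refine ⟨hsm, fun p hp => ?_⟩
  have hd : DifferentiableAt ℝ φ p :=
    (hsm.contDiffAt (hD.mem_nhds hp)).differentiableAt (by simp)
  have hev : φ =ᶠ[𝓝 p] fun p => (T p.1, A p.1 * p.2.1 + B p.1,
      P p.1 * p.2.2 + Q p.1 * p.2.1 + R p.1) := by
    filter_upwards [hD.mem_nhds hp] with y hy using hφ y hy
  rw [hev.fderiv_eq, det_ne_zero_iff_injective]
  replace hd := hev.differentiableAt_iff.1 hd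
  have S := hS p hp
  intro v hv
  obtain ⟨t, x, u⟩ := p
  obtain ⟨v1, v2, v3⟩ := v
  simp only at S
  have h1 : v1 = 0 := by
    have := deriv_line_eq_zero hd hv (.fst ℝ ℝ (ℝ × ℝ))
      (d := _ * v1) (by simpa using hasDerivAt_line S.derivT v1)
    exact (mul_eq_zero.1 this).resolve_left S.T'_ne
  subst h1
  have h2 : v2 = 0 := by
    have := deriv_line_eq_zero hd hv (.fst ℝ ℝ ℝ ∘L .snd ℝ ℝ (ℝ × ℝ))
      (by simpa using hasDerivAt_affine_line (A t) (B t) x v2)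
    exact (mul_eq_zero.1 this).resolve_left S.A_ne
  subst h2
  have h3 : v3 = 0 := by
    have := deriv_line_eq_zero hd hv (.snd ℝ ℝ ℝ ∘L .snd ℝ ℝ (ℝ × ℝ))
      (by simpa [add_assoc] using hasDerivAt_affine_line (P t) (Q t * x + R t) u v3)
    exact (mul_eq_zero.1 this).resolve_left fun h0 => S.A_ne (by rw [S.A_eq, h0, zero_mul])
  subst h3
  rfl

theorem contDiffOn_restrict {Φ : ExtPt → ExtPt} {I J K L M S : Set ℝ} {h : ℝ} {g : ℝ → ℝ}
    (hΦ : ContDiffOn ℝ ∞ Φ (I ×ˢ J ×ˢ K ×ˢ L ×ˢ M)) (hSI : S ⊆ I) (hh : h ∈ L)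
    (hg : ContDiffOn ℝ ∞ g S) (hgM : MapsTo g S M) :
    ContDiffOn ℝ ∞ (restrict Φ h g) (S ×ˢ J ×ˢ K) := by
  have h1 : ContDiffOn ℝ ∞ (fun p : BasePt => ((p.1, p.2.1, p.2.2, h, g p.1) : ExtPt))
      (S ×ˢ J ×ˢ K) := by
    have : ContDiffOn ℝ ∞ (fun p : BasePt => g p.1) (S ×ˢ J ×ˢ K) :=
      hg.comp contDiffOn_fst fun p hp => hp.1
    exact contDiffOn_fst.prodMk (contDiffOn_snd.fst.prodMk (contDiffOn_snd.snd.prodMk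
      (contDiffOn_const.prodMk this)))
  have h2 := hΦ.comp h1 fun p hp => ⟨hSI hp.1, hp.2.1, hp.2.2, hh, hgM hp.1⟩
  exact h2.fst.prodMk (h2.snd.fst.prodMk h2.snd.snd.fst)

/-- The definition asks for `g'` as a smooth function of the new time, whereas the normal form gives
it in terms of the old one. The old time is recovered by inverting the Möbius map and applying
`tauInv`. -/
theorem isGeneralizedEquivalence_of_eqOn {I J K L M : Set ℝ} (hI : IsOpen I) (hJ : IsOpen J)
    (hK : IsOpen K) (hL : IsOpen L) (hM : IsOpen M) {Φ : ExtPt → ExtPt}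
    {H α β γ δ μ₀ μ₁ : ℝ → ℝ} (F : IsParameterFamily I L H α β γ δ μ₀ μ₁)
    (hΦ : EqOn Φ (normalForm H α β γ δ μ₀ μ₁) (I ×ˢ J ×ˢ K ×ˢ L ×ˢ M)) :
    IsGeneralizedEquivalence Φ I J K L M := by
  have hΩ := isOpen_box hI hJ hK hL hM
  have hsm : ContDiffOn ℝ ∞ Φ (I ×ˢ J ×ˢ K ×ˢ L ×ˢ M) := by
    refine ContDiffOn.congr (f := normalForm H α β γ δ μ₀ μ₁) (fun q hq => ?_) hΦ
    exact (F.contDiffAt_normalForm hL hq.1 hq.2.2.2.1).contDiffWithinAt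
  refine ⟨hsm, fun q hq => ?_, ?_⟩
  · rw [(hΦ.eventuallyEq_of_mem (hΩ.mem_nhds hq)).fderiv_eq]
    exact fderiv_normalForm_det_ne_zero F hI hL hq.1 hq.2.2.2.1
  intro S h g hS hSI hh hg hgM
  have hD : IsOpen (S ×ˢ J ×ˢ K) := hS.isOpen.prod (hJ.prod hK)
  have heq : ∀ p ∈ S ×ˢ J ×ˢ K, Φ (p.1, p.2.1, p.2.2, h, g p.1) =
      normalForm H α β γ δ μ₀ μ₁ (p.1, p.2.1, p.2.2, h, g p.1) := fun p hp =>
    hΦ ⟨hSI hp.1, hp.2.1, hp.2.2, hh, hgM hp.1⟩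
  have hφ : ∀ p ∈ S ×ˢ J ×ˢ K, restrict Φ h g p =
      (newTime h (H h) (α h) (β h) (γ h) (δ h) p.1,
        coeffA h (γ h) (δ h) p.1 * p.2.1 + coeffB h (γ h) (δ h) (μ₀ h) (μ₁ h) p.1,
        coeffP h (H h) (α h) (β h) (γ h) (δ h) p.1 * p.2.2 +
          coeffQ h (H h) (α h) (β h) (γ h) (δ h) p.1 * p.2.1 +
          coeffR h (H h) (α h) (β h) (γ h) (δ h) (μ₀ h) (μ₁ h) p.1) := fun p hp => by
    rw [restrict, heq p hp]; rfl
  have hsys := fun (p : BasePt) (hp : p ∈ S ×ˢ J ×ˢ K) => F.determiningSystem hI hh (hSI hp.1)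
  -- the old time as a function of the new one
  let back : ℝ → ℝ := fun y =>
    tauInv h ((δ h * tau (H h) y - β h) / (α h - γ h * tau (H h) y))
  -- At the new time the denominator of the inverse Möbius map equals `Δ / (γτ + δ)`, hence is
  -- nonzero.
  have hback : ∀ t ∈ I, α h - γ h * tau (H h) (newTime h (H h) (α h) (β h) (γ h) (δ h) t) ≠ 0 ∧
      (δ h * tau (H h) (newTime h (H h) (α h) (β h) (γ h) (δ h) t) - β h) /
        (α h - γ h * tau (H h) (newTime h (H h) (α h) (β h) (γ h) (δ h) t)) = tau h t := by
    intro t ht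
    have hN := F.denom_ne h hh t ht
    have hΔ := F.det_ne h hh
    rw [F.tau_newTime hh ht]
    have e1 : α h - γ h * ((α h * tau h t + β h) / (γ h * tau h t + δ h)) =
        (α h * δ h - β h * γ h) / (γ h * tau h t + δ h) := by
      rw [mul_div_assoc', sub_eq_iff_eq_add, ← add_div, eq_div_iff hN]
      ring
    rw [e1]
    refine ⟨div_ne_zero hΔ hN, ?_⟩
    have e2 : δ h * ((α h * tau h t + β h) / (γ h * tau h t + δ h)) - β h =
        tau h t * ((α h * δ h - β h * γ h) / (γ h * tau h t + δ h)) := by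
      rw [mul_div_assoc', mul_div_assoc', sub_eq_iff_eq_add, div_add' _ _ _ hN]
      ring
    rw [e2, mul_div_cancel_right₀ _ (div_ne_zero hΔ hN)]
  have hback' : ∀ t ∈ I, back (newTime h (H h) (α h) (β h) (γ h) (δ h) t) = t := fun t ht => by
    simp only [back, (hback t ht).2, tauInv_tau]
  have hback_smooth : ∀ t ∈ I,
      ContDiffAt ℝ ∞ back (newTime h (H h) (α h) (β h) (γ h) (δ h) t) := by
    intro t ht
    have h1 : ContDiffAt ℝ ∞ (fun p : ℝ × ℝ => tauInv p.1 p.2) (h, tau h t) :=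
      contDiffAt_tauInv (mul_tau_lt_one _ _)
    have h2 : ContDiff ℝ ∞ (tau (H h)) :=
      contDiff_tau.comp (f := fun y : ℝ => (H h, y)) (by fun_prop)
    rw [← (hback t ht).2] at h1
    refine ContDiffAt.comp _ (f := fun y => (h, (δ h * tau (H h) y - β h) /
      (α h - γ h * tau (H h) y))) h1 ?_
    exact contDiffAt_const.prodMk (ContDiffAt.div (by fun_prop) (by fun_prop) (hback t ht).1)
  refine ⟨isPointTransformation_of_determiningSystem hD
    (contDiffOn_restrict hsm hSI hh hg.1 hgM) hφ hsys, H h,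
    fun y => coeffA h (γ h) (δ h) (back y) *
      coeffP h (H h) (α h) (β h) (γ h) (δ h) (back y) * g (back y), ⟨?_, ?_⟩, ?_, ?_⟩
  · rintro y ⟨p, hp, rfl⟩
    have hpI := hSI hp.1
    refine ContDiffAt.contDiffWithinAt ?_
    simp only [hφ p hp]
    have hbs := hback_smooth p.1 hpI
    -- The product `A P g` is the last component of the normal form, so its smoothness is inherited;
    -- `x` and `u` do not enter and are set to `0`.
    have h1 : ContDiffAt ℝ ∞ (fun t => (normalForm H α β γ δ μ₀ μ₁ (t, 0, 0, h, g t)).2.2.2.2)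
        (back (newTime h (H h) (α h) (β h) (γ h) (δ h) p.1)) := by
      rw [hback' _ hpI]
      have hgs := hg.1.contDiffAt (hS.isOpen.mem_nhds hp.1)
      exact ((F.contDiffAt_normalForm hL (q := (p.1, 0, 0, h, g p.1)) hpI hh).comp p.1
        (f := fun t => (t, 0, 0, h, g t)) (by fun_prop)).snd.snd.snd.snd
    exact h1.comp _ hbs
  · rintro y ⟨p, hp, rfl⟩
    have hpI := hSI hp.1
    have Sp := hsys p hp
    simp only [hφ p hp, hback' _ hpI]
    exact mul_ne_zero (mul_ne_zero Sp.A_ne fun h0 => Sp.A_ne (by rw [Sp.A_eq, h0, zero_mul]))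
      (hg.2 _ hp.1)
  · intro p hp
    simp only [hφ p hp, hback' _ (hSI hp.1), heq p hp, normalForm]
    exact ⟨trivial, trivial⟩
  · refine mapsEquation_of_determiningSystem hD hφ hsys fun p hp => ?_
    simp only [hback' _ (hSI hp.1)]

/-! ### Necessity: test functions and the second prolongation. -/

section Components

variable {E F : Type*} [NormedAddCommGroup E] [NormedSpace ℝ E] [NormedAddCommGroup F]
  [NormedSpace ℝ F] {f : ℝ → E × F} {f' : E × F} {s : ℝ}

theorem hasDerivAt_fst (hf : HasDerivAt f f' s) : HasDerivAt (fun s => (f s).1) f'.1 s :=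
  (ContinuousLinearMap.fst ℝ E F).hasFDerivAt.comp_hasDerivAt s hf

theorem hasDerivAt_snd (hf : HasDerivAt f f' s) : HasDerivAt (fun s => (f s).2) f'.2 s :=
  (ContinuousLinearMap.snd ℝ E F).hasFDerivAt.comp_hasDerivAt s hf

end Components

/-- An affine function of `t` with values in the interval `M` near `t₀` is an admissible value of
the functional arbitrary element on an interval. -/
theorem exists_interval_affine {I M : Set ℝ} (hI : IsOpenInterval I) (hM : IsOpenInterval M)
    (hM0 : (0 : ℝ) ∉ M) {t g : ℝ} (ht : t ∈ I) (hg : g ∈ M) (c : ℝ) :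
    ∃ S, IsOpenInterval S ∧ S ⊆ I ∧ t ∈ S ∧ (∀ s ∈ I, g + c * (s - t) ∈ M → s ∈ S) ∧
      IsAdmissibleCoeff S (fun s => g + c * (s - t)) ∧ MapsTo (fun s => g + c * (s - t)) S M := by
  have hc : Continuous (fun s : ℝ => g + c * (s - t)) := by fun_prop
  have hts : t ∈ I ∩ (fun s => g + c * (s - t)) ⁻¹' M := ⟨ht, by simpa using hg⟩
  have hord : ((fun s => g + c * (s - t)) ⁻¹' M).OrdConnected := by
    rcases le_total 0 c with h0 | h0
    · exact hM.ordConnected.preimage_mono fun a b hab => by nlinarith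
    · exact hM.ordConnected.preimage_anti fun a b hab => by nlinarith
  refine ⟨I ∩ (fun s => g + c * (s - t)) ⁻¹' M, ⟨hI.isOpen.inter (hM.isOpen.preimage hc),
    hI.ordConnected.inter hord, ⟨t, hts⟩⟩, inter_subset_left, hts, fun s hs hs' => ⟨hs, hs'⟩,
    ⟨by fun_prop, fun s hs h0 => hM0 (h0 ▸ hs.2)⟩, fun s hs => hs.2⟩

/-- A smooth map of the plane that is a local diffeomorphism at `z` transports smooth functions. -/
theorem exists_transported_function {Y : ℝ × ℝ → ℝ × ℝ} {f : ℝ × ℝ → ℝ} {z : ℝ × ℝ}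
    (hY : ContDiffAt ℝ ∞ Y z) (hf : ContDiffAt ℝ ∞ f z) (hdet : (fderiv ℝ Y z).det ≠ 0) :
    ∃ v : ℝ × ℝ → ℝ, ContDiffAt ℝ ∞ v (Y z) ∧ ∀ᶠ w in 𝓝 z, v (Y w) = f w := by
  have h1 : HasFDerivAt Y (((fderiv ℝ Y z).toContinuousLinearEquivOfDetNeZero hdet :
      (ℝ × ℝ) ≃L[ℝ] (ℝ × ℝ)) : (ℝ × ℝ) →L[ℝ] (ℝ × ℝ)) z := by
    rw [ContinuousLinearMap.coe_toContinuousLinearEquivOfDetNeZero]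
    exact (hY.differentiableAt (by simp)).hasFDerivAt
  have hs := hY.hasStrictFDerivAt' h1 (by simp)
  have hinv := hY.to_localInverse h1 (by simp)
  refine ⟨fun y => f (hY.localInverse h1 (by simp) y), ?_, ?_⟩
  · refine ContDiffAt.comp (Y z) (g := f) ?_ hinv
    rwa [hY.localInverse_apply_image h1 (by simp)]
  · filter_upwards [hs.eventually_left_inverse] with w hw
    exact congrArg f hw

/-- A quadratic polynomial with prescribed value and prescribed derivatives `u_t = a`, `u_x = b`,
`u_tt = e`, `u_xx = k` at `(t, x)`. -/
noncomputable def quadratic (t x u a b e k : ℝ) (w : ℝ × ℝ) : ℝ :=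
  u + a * (w.1 - t) + b * (w.2 - x) + e / 2 * (w.1 - t) ^ 2 + k / 2 * (w.2 - x) ^ 2

theorem contDiff_quadratic (t x u a b e k : ℝ) : ContDiff ℝ ∞ (quadratic t x u a b e k) := by
  unfold quadratic; fun_prop

theorem satisfiesAt_quadratic_iff {h t x u a b e k : ℝ} {g : ℝ → ℝ} :
    SatisfiesAt h g (quadratic t x u a b e k) (t, x) ↔ a + u * b + h * u = g t * k := by
  have hdx : ∀ w : ℝ × ℝ, dx (quadratic t x u a b e k) w = b + k * (w.2 - x) := fun w => by
    have h1 : HasDerivAt (fun y : ℝ => y - x) 1 w.2 := (hasDerivAt_id' w.2).sub_const x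
    have := ((((h1.const_mul b).const_add (u + a * (w.1 - t))).add_const
      (e / 2 * (w.1 - t) ^ 2)).add ((h1.pow 2).const_mul (k / 2)))
    unfold dx quadratic
    refine (this.congr_deriv ?_).deriv
    simp; ring
  have hdt : dt (quadratic t x u a b e k) (t, x) = a := by
    have h1 : HasDerivAt (fun s : ℝ => s - t) 1 t := (hasDerivAt_id' t).sub_const t
    have := ((((h1.const_mul a).const_add u).add_const (b * (x - x))).add
      ((h1.pow 2).const_mul (e / 2))).add_const (k / 2 * (x - x) ^ 2)
    unfold dt quadratic
    refine (this.congr_deriv ?_).deriv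
    simp
  have hdxx : dx (dx (quadratic t x u a b e k)) (t, x) = k := by
    have h1 : HasDerivAt (fun y : ℝ => y - x) 1 x := (hasDerivAt_id' x).sub_const x
    have := (h1.const_mul k).const_add b
    rw [mul_one] at this
    have h2 : dx (quadratic t x u a b e k) = fun w => b + k * (w.2 - x) := funext hdx
    rw [h2]
    exact this.deriv
  rw [SatisfiesAt, hdxx, hdt, hdx]
  simp [quadratic]

/-- The second prolongation: the relation between the derivatives of a quadratic test function and
those of its image. -/
theorem exists_jet_relation {I J K L M : Set ℝ} (hI : IsOpenInterval I) (hJ : IsOpenInterval J)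
    (hK : IsOpenInterval K) (hL : IsOpenInterval L) (hM : IsOpenInterval M) (hM0 : (0 : ℝ) ∉ M)
    {Φ : ExtPt → ExtPt} (hΦ : IsGeneralizedEquivalence Φ I J K L M) {t x u h g : ℝ}
    (ht : t ∈ I) (hx : x ∈ J) (hu : u ∈ K) (hh : h ∈ L) (hg : g ∈ M) (c a b e k : ℝ)
    (hdet : (fderiv ℝ Φ (t, x, u, h, g) (1, 0, a, 0, c)).1 *
        (fderiv ℝ Φ (t, x, u, h, g) (0, 1, b, 0, 0)).2.1 -
      (fderiv ℝ Φ (t, x, u, h, g) (0, 1, b, 0, 0)).1 *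
        (fderiv ℝ Φ (t, x, u, h, g) (1, 0, a, 0, c)).2.1 ≠ 0) :
    ∃ vt vx vxx : ℝ,
      (∀ n₁ n₂ : ℝ, ∀ w : ExtPt, w = (n₁, n₂, a * n₁ + b * n₂, 0, c * n₁) →
        (fderiv ℝ Φ (t, x, u, h, g) w).2.2.1 = vt * (fderiv ℝ Φ (t, x, u, h, g) w).1 +
          vx * (fderiv ℝ Φ (t, x, u, h, g) w).2.1) ∧
      (∀ n₁ n₂ : ℝ, ∀ w w₂ : ExtPt, w = (n₁, n₂, a * n₁ + b * n₂, 0, c * n₁) →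
        w₂ = fderiv ℝ (fderiv ℝ Φ) (t, x, u, h, g) w w +
          fderiv ℝ Φ (t, x, u, h, g) (0, 0, e * n₁ ^ 2 + k * n₂ ^ 2, 0, 0) →
        (fderiv ℝ Φ (t, x, u, h, g) w).1 = 0 →
        w₂.2.2.1 = vxx * (fderiv ℝ Φ (t, x, u, h, g) w).2.1 ^ 2 + vt * w₂.1 + vx * w₂.2.1) ∧
      (a + u * b + h * u = g * k ↔
        vt + (Φ (t, x, u, h, g)).2.2.1 * vx +
          (Φ (t, x, u, h, g)).2.2.2.1 * (Φ (t, x, u, h, g)).2.2.1 =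
        (Φ (t, x, u, h, g)).2.2.2.2 * vxx) := by
  obtain ⟨S, hS, hSI, htS, -, hadm, hmaps⟩ := exists_interval_affine hI hM hM0 ht hg c
  obtain ⟨-, h', g', -, hval, hE⟩ := hΦ.2.2 S h _ hS hSI hh hadm hmaps
  have hΩ := isOpen_box hI.isOpen hJ.isOpen hK.isOpen hL.isOpen hM.isOpen
  set q : ExtPt := (t, x, u, h, g) with hq
  have hqΩ : q ∈ I ×ˢ J ×ˢ K ×ˢ L ×ˢ M := ⟨ht, hx, hu, hh, hg⟩
  have hsm : ContDiffAt ℝ ∞ Φ q := hΦ.1.contDiffAt (hΩ.mem_nhds hqΩ)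
  set u₀ := quadratic t x u a b e k with hu₀
  have hu₀z : u₀ (t, x) = u := by simp [hu₀, quadratic]
  let ι : ℝ × ℝ → ExtPt := fun w => (w.1, w.2, u₀ w, h, g + c * (w.1 - t))
  have hιz : ι (t, x) = q := by simp [ι, hu₀z, hq]
  have hιs : ContDiff ℝ ∞ ι := by
    have := contDiff_quadratic t x u a b e k
    fun_prop
  have hΦι : ContDiffAt ℝ ∞ (fun w => Φ (ι w)) (t, x) :=
    ContDiffAt.comp (t, x) (g := Φ) (by rwa [hιz]) hιs.contDiffAt
  set φ := restrict Φ h (fun s => g + c * (s - t)) with hφ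
  have hbase : baseAlong φ u₀ = fun w => ((Φ (ι w)).1, (Φ (ι w)).2.1) := rfl
  have hvalue : valueAlong φ u₀ = fun w => (Φ (ι w)).2.2.1 := rfl
  have hbs : ContDiffAt ℝ ∞ (baseAlong φ u₀) (t, x) := hΦι.fst.prodMk hΦι.snd.fst
  have hvs : ContDiffAt ℝ ∞ (valueAlong φ u₀) (t, x) := hΦι.snd.snd.fst
  -- the images of straight lines in the plane of the independent variables
  let cv : ℝ → ℝ → ℝ → ExtPt := fun n₁ n₂ s => ι (t + s * n₁, x + s * n₂)
  have hcv0 : ∀ n₁ n₂, cv n₁ n₂ 0 = q := fun n₁ n₂ => by simp [cv, hιz]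
  let cv' : ℝ → ℝ → ℝ → ExtPt := fun n₁ n₂ s =>
    (n₁, n₂, a * n₁ + b * n₂ + s * (e * n₁ ^ 2 + k * n₂ ^ 2), 0, c * n₁)
  have hcv : ∀ n₁ n₂ s, HasDerivAt (cv n₁ n₂) (cv' n₁ n₂ s) s := fun n₁ n₂ s => by
    have l : ∀ p n : ℝ, HasDerivAt (fun s : ℝ => p + s * n) n s := fun p n => by
      simpa using ((hasDerivAt_id' s).mul_const n).const_add p
    have l1 := (l t n₁).sub_const t
    have l2 := (l x n₂).sub_const x
    refine (l t n₁).prodMk ((l x n₂).prodMk (HasDerivAt.prodMk ?_ ((hasDerivAt_const s h).prodMk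
      ((l1.const_mul c).const_add g))))
    simp only [hu₀, quadratic]
    refine (((((l1.const_mul a).const_add u).add (l2.const_mul b)).add
      ((l1.pow 2).const_mul (e / 2))).add ((l2.pow 2).const_mul (k / 2))).congr_deriv ?_
    simp
    ring
  have hcv' : ∀ n₁ n₂, HasDerivAt (cv' n₁ n₂) (0, 0, e * n₁ ^ 2 + k * n₂ ^ 2, 0, 0) 0 :=
    fun n₁ n₂ => by
      refine (hasDerivAt_const _ _).prodMk ((hasDerivAt_const _ _).prodMk (HasDerivAt.prodMk ?_
        ((hasDerivAt_const _ _).prodMk (hasDerivAt_const _ _))))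
      simpa using ((hasDerivAt_id' (0 : ℝ)).mul_const (e * n₁ ^ 2 + k * n₂ ^ 2)).const_add
        (a * n₁ + b * n₂)
  have hcurve := fun n₁ n₂ => hasDerivAt_comp_curve (f := Φ) (w := cv n₁ n₂) (w' := cv' n₁ n₂)
    (s₀ := 0) (by rw [hcv0]; exact hsm) (Eventually.of_forall (hcv n₁ n₂)) (hcv' n₁ n₂)
  have hcv'0 : ∀ n₁ n₂, cv' n₁ n₂ 0 = (n₁, n₂, a * n₁ + b * n₂, 0, c * n₁) := fun n₁ n₂ => by
    simp [cv']
  -- the Jacobian of the new independent variables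
  have hfd : ∀ n : ℝ × ℝ, fderiv ℝ (baseAlong φ u₀) (t, x) n =
      ((fderiv ℝ Φ q (n.1, n.2, a * n.1 + b * n.2, 0, c * n.1)).1,
       (fderiv ℝ Φ q (n.1, n.2, a * n.1 + b * n.2, 0, c * n.1)).2.1) := fun n => by
    have h1 : HasDerivAt (fun s : ℝ => baseAlong φ u₀ ((t, x) + s • n)) _ 0 :=
      (hbs.differentiableAt (by simp)).hasFDerivAt.hasLineDerivAt n
    have h2 := (hcurve n.1 n.2).1.self_of_nhds
    rw [hcv0, hcv'0] at h2
    have h3 := (hasDerivAt_fst h2).prodMk (hasDerivAt_fst (hasDerivAt_snd h2))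
    exact h1.unique h3
  have hjac : (fderiv ℝ (baseAlong φ u₀) (t, x)).det ≠ 0 := by
    rw [det_ne_zero_iff_injective]
    rintro ⟨n₁, n₂⟩ hn
    rw [hfd] at hn
    have r : ((n₁, n₂, a * n₁ + b * n₂, 0, c * n₁) : ExtPt) =
        n₁ • ((1, 0, a, 0, c) : ExtPt) + n₂ • ((0, 1, b, 0, 0) : ExtPt) := by
      simp [mul_comm]
    simp only [r, map_add, map_smul, Prod.fst_add, Prod.snd_add, Prod.smul_fst, Prod.smul_snd,
      smul_eq_mul, Prod.mk_eq_zero] at hn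
    obtain ⟨r1, r2⟩ := hn
    have e1 : n₁ = 0 := by
      refine (mul_eq_zero.1 (?_ : n₁ * _ = 0)).resolve_right hdet
      linear_combination (fderiv ℝ Φ q (0, 1, b, 0, 0)).2.1 * r1 -
        (fderiv ℝ Φ q (0, 1, b, 0, 0)).1 * r2
    have e2 : n₂ = 0 := by
      refine (mul_eq_zero.1 (?_ : n₂ * _ = 0)).resolve_right hdet
      linear_combination (fderiv ℝ Φ q (1, 0, a, 0, c)).1 * r2 -
        (fderiv ℝ Φ q (1, 0, a, 0, c)).2.1 * r1
    rw [e1, e2]; rfl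
  -- The image of the graph of the test function is a graph near the image point by the inverse
  -- function theorem, so the hypothesis on `Φ` applies to this `v`.
  obtain ⟨v, hv, hvev⟩ := exists_transported_function hbs hvs hjac
  have hY : baseAlong φ u₀ (t, x) = ((Φ q).1, (Φ q).2.1) := by rw [hbase]; simp only [hιz]
  have hpD : (t, x, u) ∈ S ×ˢ J ×ˢ K := ⟨htS, hx, hu⟩
  have hmap := hE u₀ v (t, x) (by simpa only [hu₀z] using hpD)
    (contDiff_quadratic t x u a b e k).contDiffAt hjac hv hvev
  have hvY := hvev.self_of_nhds
  rw [hvalue, hY] at hvY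
  simp only [hιz] at hvY
  rw [hY] at hv hmap
  have hvd : DifferentiableAt ℝ v ((Φ q).1, (Φ q).2.1) := hv.differentiableAt (by simp)
  have hval' := hval _ hpD
  have hgz : g + c * (t - t) = g := by ring
  simp only [restrict, hgz, hφ] at hval'
  rw [satisfiesAt_quadratic_iff, SatisfiesAt, dt_eq_fderiv hvd, dx_eq_fderiv hvd,
    dx_dx_eq_fderiv hv, hvY, hgz, ← hval'.1, ← hval'.2] at hmap
  have r1 : ∀ p : ℝ × ℝ, p = p.1 • ((1, 0) : ℝ × ℝ) + p.2 • ((0, 1) : ℝ × ℝ) := fun p => by simp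
  -- comparison of derivatives along lines
  have hline : ∀ n₁ n₂ : ℝ,
      (fderiv ℝ v ((Φ q).1, (Φ q).2.1) ((fderiv ℝ Φ q (cv' n₁ n₂ 0)).1,
        (fderiv ℝ Φ q (cv' n₁ n₂ 0)).2.1) = (fderiv ℝ Φ q (cv' n₁ n₂ 0)).2.2.1) ∧
      ∀ w₂ : ExtPt, w₂ = fderiv ℝ (fderiv ℝ Φ) q (cv' n₁ n₂ 0) (cv' n₁ n₂ 0) +
          fderiv ℝ Φ q (0, 0, e * n₁ ^ 2 + k * n₂ ^ 2, 0, 0) →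
        fderiv ℝ (fderiv ℝ v) ((Φ q).1, (Φ q).2.1)
          ((fderiv ℝ Φ q (cv' n₁ n₂ 0)).1, (fderiv ℝ Φ q (cv' n₁ n₂ 0)).2.1)
          ((fderiv ℝ Φ q (cv' n₁ n₂ 0)).1, (fderiv ℝ Φ q (cv' n₁ n₂ 0)).2.1) +
        fderiv ℝ v ((Φ q).1, (Φ q).2.1) (w₂.1, w₂.2.1) = w₂.2.2.1 := by
    intro n₁ n₂
    obtain ⟨c1, c2⟩ := hcurve n₁ n₂
    have prBase : ∀ {f : ℝ → ExtPt} {f' : ExtPt} {s : ℝ}, HasDerivAt f f' s →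
        HasDerivAt (fun s => ((f s).1, (f s).2.1)) (f'.1, f'.2.1) s := fun {f f' s} hf =>
      (hasDerivAt_fst hf).prodMk (hasDerivAt_fst (hasDerivAt_snd hf))
    have prVal : ∀ {f : ℝ → ExtPt} {f' : ExtPt} {s : ℝ}, HasDerivAt f f' s →
        HasDerivAt (fun s => (f s).2.2.1) f'.2.2.1 s := fun {f f' s} hf =>
      hasDerivAt_fst (hasDerivAt_snd (hasDerivAt_snd hf))
    have hlc : ContinuousAt (fun s : ℝ => ((t + s * n₁, x + s * n₂) : ℝ × ℝ)) 0 := by fun_prop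
    have hlt : Tendsto (fun s : ℝ => ((t + s * n₁, x + s * n₂) : ℝ × ℝ)) (𝓝 0) (𝓝 (t, x)) := by
      simpa using hlc.tendsto
    have hev : ∀ᶠ s in 𝓝 (0 : ℝ), v ((Φ (cv n₁ n₂ s)).1, (Φ (cv n₁ n₂ s)).2.1) =
        (Φ (cv n₁ n₂ s)).2.2.1 := hlt.eventually hvev
    obtain ⟨d1, d2⟩ := hasDerivAt_comp_curve (f := v) (s₀ := 0)
      (w := fun s => ((Φ (cv n₁ n₂ s)).1, (Φ (cv n₁ n₂ s)).2.1)) (by rw [hcv0]; exact hv)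
      (c1.mono fun s hs => prBase hs) (prBase c2)
    have f1 : ∀ᶠ s in 𝓝 (0 : ℝ), fderiv ℝ v ((Φ (cv n₁ n₂ s)).1, (Φ (cv n₁ n₂ s)).2.1)
        ((fderiv ℝ Φ (cv n₁ n₂ s) (cv' n₁ n₂ s)).1, (fderiv ℝ Φ (cv n₁ n₂ s) (cv' n₁ n₂ s)).2.1) =
        (fderiv ℝ Φ (cv n₁ n₂ s) (cv' n₁ n₂ s)).2.2.1 := by
      filter_upwards [d1, c1, hev.eventually_nhds] with s hs hs' hss
      exact hs.unique ((prVal hs').congr_of_eventuallyEq hss)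
    have f2 := d2.unique ((prVal c2).congr_of_eventuallyEq f1)
    have f1 := f1.self_of_nhds
    simp only [hcv0] at f1 f2
    exact ⟨f1, fun w₂ hw₂ => by rw [hw₂]; exact f2⟩
  refine ⟨_, _, _, ?_, ?_, hmap⟩
  · rintro n₁ n₂ w rfl
    have h1 := (hline n₁ n₂).1
    rw [hcv'0, r1 ((fderiv ℝ Φ q _).1, _)] at h1
    simp only [map_add, map_smul, smul_eq_mul] at h1
    linear_combination -h1
  -- Along a direction in which the new time is stationary, only `v_xx` survives from the Hessian of
  -- `v`.
  · rintro n₁ n₂ w w₂ rfl hw₂ h0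
    have h1 := (hline n₁ n₂).2 w₂ (by rw [hcv'0]; exact hw₂)
    rw [hcv'0, r1 (w₂.1, _), r1 ((fderiv ℝ Φ q _).1, _), h0] at h1
    simp only [map_add, map_smul, smul_eq_mul, zero_smul, zero_add, smul_apply] at h1
    linear_combination -h1

/-! ### Necessity: scalar components of `Φ` and the new arbitrary elements. -/

/-- The new `t` as a function of `(t, x, u, h, g)`. -/
def newT (Φ : ExtPt → ExtPt) (q : ExtPt) : ℝ := (Φ q).1

/-- The new `x` as a function of `(t, x, u, h, g)`. -/
def newX (Φ : ExtPt → ExtPt) (q : ExtPt) : ℝ := (Φ q).2.1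

/-- The new `u` as a function of `(t, x, u, h, g)`. -/
def newU (Φ : ExtPt → ExtPt) (q : ExtPt) : ℝ := (Φ q).2.2.1

/-- The new `h` as a function of `(t, x, u, h, g)`. -/
def newH (Φ : ExtPt → ExtPt) (q : ExtPt) : ℝ := (Φ q).2.2.2.1

/-- The new `g` as a function of `(t, x, u, h, g)`. -/
def newG (Φ : ExtPt → ExtPt) (q : ExtPt) : ℝ := (Φ q).2.2.2.2

/-- The domain of a transformation of `(t, x, u, h, g)`-space. -/
def box (I J K L M : Set ℝ) : Set ExtPt := I ×ˢ J ×ˢ K ×ˢ L ×ˢ M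

/-- `Φ` is a generalized equivalence transformation on a product of open intervals. -/
structure IsEquivalenceOnBox (Φ : ExtPt → ExtPt) (I J K L M : Set ℝ) : Prop where
  hI : IsOpenInterval I
  hJ : IsOpenInterval J
  hK : IsOpenInterval K
  hL : IsOpenInterval L
  hM : IsOpenInterval M
  hM0 : (0 : ℝ) ∉ M
  hΦ : IsGeneralizedEquivalence Φ I J K L M

theorem apply_ext_basis {F : Type*} [NormedAddCommGroup F] [NormedSpace ℝ F] (A : ExtPt →L[ℝ] F)
    (a b c d e : ℝ) : A (a, b, c, d, e) = a • A (1, 0, 0, 0, 0) + b • A (0, 1, 0, 0, 0) +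
      c • A (0, 0, 1, 0, 0) + d • A (0, 0, 0, 1, 0) + e • A (0, 0, 0, 0, 1) := by
  simp only [← map_smul, ← map_add]
  simp

theorem _root_.IsOpenInterval.exists_ne {S : Set ℝ} (hS : IsOpenInterval S) {a : ℝ} (ha : a ∈ S) :
    ∃ b ∈ S, b ≠ a := by
  have h1 : S ∈ 𝓝[≠] a := nhdsWithin_le_nhds (hS.isOpen.mem_nhds ha)
  have h2 : ∀ᶠ s in 𝓝[≠] a, s ∈ S ∧ s ∈ ({a}ᶜ : Set ℝ) :=
    Filter.Eventually.and h1 eventually_mem_nhdsWithin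
  exact h2.exists

/-- A differentiable function on a convex open set is invariant under the shifts along which
its derivative vanishes. -/
theorem shift_eq_of_fderiv_eq_zero {E : Type*} [NormedAddCommGroup E] [NormedSpace ℝ E]
    {Ω : Set E} (hc : Convex ℝ Ω) {f : E → ℝ} (hf : ∀ q ∈ Ω, DifferentiableAt ℝ f q) {v : E}
    (hv : ∀ q ∈ Ω, fderiv ℝ f q v = 0) {q : E} (hq : q ∈ Ω) (hqv : q + v ∈ Ω) :
    f (q + v) = f q := by
  have hmem : ∀ s ∈ Icc (0 : ℝ) 1, q + s • v ∈ Ω := fun s hs =>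
    hc.add_smul_mem hq hqv hs
  have hd : ∀ s ∈ Icc (0 : ℝ) 1, HasDerivAt (fun s : ℝ => f (q + s • v)) 0 s := fun s hs => by
    have h1 : HasDerivAt (fun s : ℝ => q + s • v) v s := by
      simpa using ((hasDerivAt_id' s).smul_const v).const_add q
    have h2 := (hf _ (hmem s hs)).hasFDerivAt.comp_hasDerivAt s h1
    rwa [hv _ (hmem s hs)] at h2
  have := constant_of_has_deriv_right_zero (a := 0) (b := 1)
    (fun s hs => (hd s hs).continuousAt.continuousWithinAt)
    (fun s hs => (hd s (Ico_subset_Icc_self hs)).hasDerivWithinAt) 1 (by simp)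
  simpa using this

theorem fderiv_shift {E F : Type*} [NormedAddCommGroup E] [NormedSpace ℝ E] [NormedAddCommGroup F]
    [NormedSpace ℝ F] {f : E → F} {q v : E} (h : ∀ᶠ y in 𝓝 q, f (y + v) = f y) :
    fderiv ℝ f (q + v) = fderiv ℝ f q := by
  rw [← fderiv_comp_add_right]
  exact EventuallyEq.fderiv_eq h

theorem fderiv_fderiv_apply {E : Type*} [NormedAddCommGroup E] [NormedSpace ℝ E] {f : E → ℝ} {q : E}
    (hf : ContDiffAt ℝ ∞ f q) (v w : E) :
    fderiv ℝ (fun y => fderiv ℝ f y v) q w = fderiv ℝ (fderiv ℝ f) q w v := by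
  have h2 : DifferentiableAt ℝ (fderiv ℝ f) q :=
    (hf.fderiv_right (m := 1) (by norm_cast)).differentiableAt one_ne_zero
  rw [fderiv_clm_apply h2 (differentiableAt_const v)]
  simp

namespace IsEquivalenceOnBox

variable {Φ : ExtPt → ExtPt} {I J K L M : Set ℝ}

theorem isOpen (E : IsEquivalenceOnBox Φ I J K L M) : IsOpen (box I J K L M) :=
  isOpen_box E.hI.isOpen E.hJ.isOpen E.hK.isOpen E.hL.isOpen E.hM.isOpen

theorem convex (E : IsEquivalenceOnBox Φ I J K L M) : Convex ℝ (box I J K L M) :=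
  E.hI.ordConnected.convex.prod (E.hJ.ordConnected.convex.prod (E.hK.ordConnected.convex.prod
    (E.hL.ordConnected.convex.prod E.hM.ordConnected.convex)))

theorem smooth (E : IsEquivalenceOnBox Φ I J K L M) {q : ExtPt} (hq : q ∈ box I J K L M) :
    ContDiffAt ℝ ∞ Φ q := E.hΦ.1.contDiffAt (E.isOpen.mem_nhds hq)

theorem smoothT (E : IsEquivalenceOnBox Φ I J K L M) {q : ExtPt} (hq : q ∈ box I J K L M) :
    ContDiffAt ℝ ∞ (newT Φ) q := (E.smooth hq).fst

theorem smoothX (E : IsEquivalenceOnBox Φ I J K L M) {q : ExtPt} (hq : q ∈ box I J K L M) :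
    ContDiffAt ℝ ∞ (newX Φ) q := (E.smooth hq).snd.fst

theorem smoothU (E : IsEquivalenceOnBox Φ I J K L M) {q : ExtPt} (hq : q ∈ box I J K L M) :
    ContDiffAt ℝ ∞ (newU Φ) q := (E.smooth hq).snd.snd.fst

theorem smoothH (E : IsEquivalenceOnBox Φ I J K L M) {q : ExtPt} (hq : q ∈ box I J K L M) :
    ContDiffAt ℝ ∞ (newH Φ) q := (E.smooth hq).snd.snd.snd.fst

theorem hasFDerivAt (E : IsEquivalenceOnBox Φ I J K L M) {q : ExtPt} (hq : q ∈ box I J K L M) :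
    HasFDerivAt Φ (fderiv ℝ Φ q) q := ((E.smooth hq).differentiableAt (by simp)).hasFDerivAt

theorem fderivT (E : IsEquivalenceOnBox Φ I J K L M) {q : ExtPt} (hq : q ∈ box I J K L M)
    (w : ExtPt) : fderiv ℝ (newT Φ) q w = (fderiv ℝ Φ q w).1 := by
  have : HasFDerivAt (newT Φ) _ q := (E.hasFDerivAt hq).fst
  rw [this.fderiv]; rfl

theorem fderivX (E : IsEquivalenceOnBox Φ I J K L M) {q : ExtPt} (hq : q ∈ box I J K L M)
    (w : ExtPt) : fderiv ℝ (newX Φ) q w = (fderiv ℝ Φ q w).2.1 := by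
  have : HasFDerivAt (newX Φ) _ q := (E.hasFDerivAt hq).snd.fst
  rw [this.fderiv]; rfl

theorem fderivU (E : IsEquivalenceOnBox Φ I J K L M) {q : ExtPt} (hq : q ∈ box I J K L M)
    (w : ExtPt) : fderiv ℝ (newU Φ) q w = (fderiv ℝ Φ q w).2.2.1 := by
  have : HasFDerivAt (newU Φ) _ q := (E.hasFDerivAt hq).snd.snd.fst
  rw [this.fderiv]; rfl

theorem hasFDerivAt_fderiv (E : IsEquivalenceOnBox Φ I J K L M) {q : ExtPt}
    (hq : q ∈ box I J K L M) (w : ExtPt) : HasFDerivAt (fun y => fderiv ℝ Φ y w)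
      ((fderiv ℝ (fderiv ℝ Φ) q).flip w) q := by
  have h2 : DifferentiableAt ℝ (fderiv ℝ Φ) q :=
    ((E.smooth hq).fderiv_right (m := 1) (by norm_cast)).differentiableAt one_ne_zero
  exact (h2.hasFDerivAt.clm_apply (hasFDerivAt_const w q)).congr_fderiv (by simp)

theorem eventually_mem (E : IsEquivalenceOnBox Φ I J K L M) {q : ExtPt}
    (hq : q ∈ box I J K L M) : ∀ᶠ y in 𝓝 q, y ∈ box I J K L M := E.isOpen.mem_nhds hq

theorem fderiv_fderivT (E : IsEquivalenceOnBox Φ I J K L M) {q : ExtPt} (hq : q ∈ box I J K L M)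
    (w w' : ExtPt) :
    fderiv ℝ (fderiv ℝ (newT Φ)) q w w' = (fderiv ℝ (fderiv ℝ Φ) q w w').1 := by
  rw [← fderiv_fderiv_apply (E.smoothT hq)]
  rw [EventuallyEq.fderiv_eq ((E.eventually_mem hq).mono fun y hy => E.fderivT hy w'),
    ((E.hasFDerivAt_fderiv hq w').fst).fderiv]
  rfl

theorem fderiv_fderivX (E : IsEquivalenceOnBox Φ I J K L M) {q : ExtPt} (hq : q ∈ box I J K L M)
    (w w' : ExtPt) :
    fderiv ℝ (fderiv ℝ (newX Φ)) q w w' = (fderiv ℝ (fderiv ℝ Φ) q w w').2.1 := by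
  rw [← fderiv_fderiv_apply (E.smoothX hq)]
  rw [EventuallyEq.fderiv_eq ((E.eventually_mem hq).mono fun y hy => E.fderivX hy w'),
    ((E.hasFDerivAt_fderiv hq w').snd.fst).fderiv]
  rfl

theorem fderiv_fderivU (E : IsEquivalenceOnBox Φ I J K L M) {q : ExtPt} (hq : q ∈ box I J K L M)
    (w w' : ExtPt) :
    fderiv ℝ (fderiv ℝ (newU Φ)) q w w' = (fderiv ℝ (fderiv ℝ Φ) q w w').2.2.1 := by
  rw [← fderiv_fderiv_apply (E.smoothU hq)]
  rw [EventuallyEq.fderiv_eq ((E.eventually_mem hq).mono fun y hy => E.fderivU hy w'),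
    ((E.hasFDerivAt_fderiv hq w').snd.snd.fst).fderiv]
  rfl

/-- The Jacobian of the point transformation with `g' = c` is nonzero. -/
theorem exists_preimage (E : IsEquivalenceOnBox Φ I J K L M) {q : ExtPt} (hq : q ∈ box I J K L M)
    (c a₁ a₂ a₃ : ℝ) : ∃ n₁ n₂ n₃ : ℝ, fderiv ℝ (newT Φ) q (n₁, n₂, n₃, 0, c * n₁) = a₁ ∧
      fderiv ℝ (newX Φ) q (n₁, n₂, n₃, 0, c * n₁) = a₂ ∧
      fderiv ℝ (newU Φ) q (n₁, n₂, n₃, 0, c * n₁) = a₃ := by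
  simp only [E.fderivT hq, E.fderivX hq, E.fderivU hq]
  obtain ⟨t, x, u, h, g⟩ := q
  obtain ⟨ht, hx, hu, hh, hg⟩ := hq
  obtain ⟨S, hS, hSI, htS, -, hadm, hmaps⟩ := exists_interval_affine E.hI E.hM E.hM0 ht hg c
  have hpt := (E.hΦ.2.2 S h _ hS hSI hh hadm hmaps).1
  have hp : (t, x, u) ∈ S ×ˢ J ×ˢ K := ⟨htS, hx, hu⟩
  have hD : IsOpen (S ×ˢ J ×ˢ K) := hS.isOpen.prod (E.hJ.isOpen.prod E.hK.isOpen)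
  obtain ⟨⟨n₁, n₂, n₃⟩, hn⟩ := surjective_of_det_ne_zero _ (hpt.2 _ hp) (a₁, a₂, a₃)
  have h1 := ((hpt.1.contDiffAt (hD.mem_nhds hp)).differentiableAt
    (by simp)).hasFDerivAt.hasLineDerivAt (n₁, n₂, n₃)
  have h2 : HasDerivAt (fun s : ℝ =>
      ((t + s * n₁, x + s * n₂, u + s * n₃, h, g + c * (t + s * n₁ - t)) : ExtPt))
      (n₁, n₂, n₃, 0, c * n₁) 0 := by
    have l : ∀ p n : ℝ, HasDerivAt (fun s : ℝ => p + s * n) n 0 := fun p n => by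
      simpa using ((hasDerivAt_id' (0 : ℝ)).mul_const n).const_add p
    exact (l t n₁).prodMk ((l x n₂).prodMk ((l u n₃).prodMk ((hasDerivAt_const _ h).prodMk
      ((((l t n₁).sub_const t).const_mul c).const_add g))))
  have h3 := (E.hasFDerivAt (q := (t, x, u, h, g))
    ⟨ht, hx, hu, hh, hg⟩).comp_hasDerivAt_of_eq (0 : ℝ) h2 (by simp)
  have h4 := (hasDerivAt_fst h3).prodMk ((hasDerivAt_fst (hasDerivAt_snd h3)).prodMk
    (hasDerivAt_fst (hasDerivAt_snd (hasDerivAt_snd h3))))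
  have h5 := hn.symm.trans (HasDerivAt.unique h1 h4)
  simp only [Prod.mk.injEq] at h5
  exact ⟨n₁, n₂, n₃, h5.1.symm, h5.2.1.symm, h5.2.2.symm⟩

theorem newG_ne_zero (E : IsEquivalenceOnBox Φ I J K L M) {q : ExtPt} (hq : q ∈ box I J K L M) :
    newG Φ q ≠ 0 := by
  obtain ⟨t, x, u, h, g⟩ := q
  obtain ⟨ht, hx, hu, hh, hg⟩ := hq
  obtain ⟨S, hS, hSI, htS, -, hadm, hmaps⟩ := exists_interval_affine E.hI E.hM E.hM0 ht hg 0
  obtain ⟨-, h', g', hadm', hval, -⟩ := E.hΦ.2.2 S h _ hS hSI hh hadm hmaps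
  have hp : (t, x, u) ∈ S ×ˢ J ×ˢ K := ⟨htS, hx, hu⟩
  have := (hval _ hp).2
  simp only [zero_mul, add_zero] at this
  rw [newG, this]
  exact hadm'.2 _ ⟨_, hp, by simp⟩

/-- The new values of the arbitrary elements. -/
theorem new_elements (E : IsEquivalenceOnBox Φ I J K L M) {t₁ x₁ u₁ g₁ t₂ x₂ u₂ g₂ h : ℝ}
    (h₁ : (t₁, x₁, u₁, h, g₁) ∈ box I J K L M) (h₂ : (t₂, x₂, u₂, h, g₂) ∈ box I J K L M)
    (hne : t₁ ≠ t₂ ∨ g₁ = g₂) :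
    newH Φ (t₁, x₁, u₁, h, g₁) = newH Φ (t₂, x₂, u₂, h, g₂) ∧
    (newT Φ (t₁, x₁, u₁, h, g₁) = newT Φ (t₂, x₂, u₂, h, g₂) →
      newG Φ (t₁, x₁, u₁, h, g₁) = newG Φ (t₂, x₂, u₂, h, g₂)) := by
  obtain ⟨ht, hx, hu, hh, hg⟩ := h₁
  obtain ⟨ht₂, hx₂, hu₂, -, hg₂⟩ := h₂
  -- The slope makes the affine `g` take the value `g₁` at `t₁` and `g₂` at `t₂`. If `g₁ = g₂` it is
  -- zero, also for `t₁ = t₂`.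
  obtain ⟨S, hS, hSI, htS, hmem, hadm, hmaps⟩ := exists_interval_affine E.hI E.hM E.hM0 ht hg
    ((g₂ - g₁) / (t₂ - t₁))
  obtain ⟨-, h', g', hadm', hval, -⟩ := E.hΦ.2.2 S h _ hS hSI hh hadm hmaps
  have hg₂' : g₁ + (g₂ - g₁) / (t₂ - t₁) * (t₂ - t₁) = g₂ := by
    rcases hne with hne | hne
    · rw [div_mul_cancel₀ _ (sub_ne_zero.2 hne.symm)]; ring
    · rw [hne]; simp
  have hg₁' : g₁ + (g₂ - g₁) / (t₂ - t₁) * (t₁ - t₁) = g₁ := by ring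
  have e1 := hval (t₁, x₁, u₁) ⟨htS, hx, hu⟩
  have e2 := hval (t₂, x₂, u₂) ⟨hmem _ ht₂ (by rw [hg₂']; exact hg₂), hx₂, hu₂⟩
  simp only [restrict, hg₂', hg₁'] at e1 e2
  refine ⟨e1.1.trans e2.1.symm, fun hT => ?_⟩
  simp only [newT] at hT
  simp only [newG]
  rw [e1.2, e2.2, hT]

/-- Points with the same `t` and different `g` do not lie on the graph of a single coefficient, so
the comparison goes through a point at a third time. -/
theorem newH_eq (E : IsEquivalenceOnBox Φ I J K L M) {t₁ x₁ u₁ g₁ t₂ x₂ u₂ g₂ h : ℝ}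
    (h₁ : (t₁, x₁, u₁, h, g₁) ∈ box I J K L M) (h₂ : (t₂, x₂, u₂, h, g₂) ∈ box I J K L M) :
    newH Φ (t₁, x₁, u₁, h, g₁) = newH Φ (t₂, x₂, u₂, h, g₂) := by
  obtain ⟨t₃, ht₃, hne⟩ : ∃ t₃ ∈ I, t₃ ≠ t₁ := E.hI.exists_ne h₁.1
  have h₃ : (t₃, x₂, u₂, h, g₂) ∈ box I J K L M := ⟨ht₃, h₂.2⟩
  exact (E.new_elements h₁ h₃ (.inl hne.symm)).1.trans (E.new_elements h₃ h₂ (.inr rfl)).1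

theorem jet_relation (E : IsEquivalenceOnBox Φ I J K L M) {t x u h g : ℝ}
    (hq : (t, x, u, h, g) ∈ box I J K L M) (c a b e k : ℝ)
    (hdet : fderiv ℝ (newT Φ) (t, x, u, h, g) (1, 0, a, 0, c) *
        fderiv ℝ (newX Φ) (t, x, u, h, g) (0, 1, b, 0, 0) -
      fderiv ℝ (newT Φ) (t, x, u, h, g) (0, 1, b, 0, 0) *
        fderiv ℝ (newX Φ) (t, x, u, h, g) (1, 0, a, 0, c) ≠ 0) :
    ∃ vt vx vxx : ℝ,
      (∀ n₁ n₂ : ℝ, ∀ w : ExtPt, w = (n₁, n₂, a * n₁ + b * n₂, 0, c * n₁) →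
        fderiv ℝ (newU Φ) (t, x, u, h, g) w = vt * fderiv ℝ (newT Φ) (t, x, u, h, g) w +
          vx * fderiv ℝ (newX Φ) (t, x, u, h, g) w) ∧
      (∀ n₁ n₂ : ℝ, ∀ w w₂ : ExtPt, w = (n₁, n₂, a * n₁ + b * n₂, 0, c * n₁) →
        w₂ = (0, 0, e * n₁ ^ 2 + k * n₂ ^ 2, 0, 0) →
        fderiv ℝ (newT Φ) (t, x, u, h, g) w = 0 →
        fderiv ℝ (fderiv ℝ (newU Φ)) (t, x, u, h, g) w w +
            fderiv ℝ (newU Φ) (t, x, u, h, g) w₂ =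
          vxx * fderiv ℝ (newX Φ) (t, x, u, h, g) w ^ 2 +
          vt * (fderiv ℝ (fderiv ℝ (newT Φ)) (t, x, u, h, g) w w +
            fderiv ℝ (newT Φ) (t, x, u, h, g) w₂) +
          vx * (fderiv ℝ (fderiv ℝ (newX Φ)) (t, x, u, h, g) w w +
            fderiv ℝ (newX Φ) (t, x, u, h, g) w₂)) ∧
      (a + u * b + h * u = g * k ↔
        vt + newU Φ (t, x, u, h, g) * vx + newH Φ (t, x, u, h, g) * newU Φ (t, x, u, h, g) =
        newG Φ (t, x, u, h, g) * vxx) := by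
  simp only [E.fderivT hq, E.fderivX hq] at hdet
  obtain ⟨vt, vx, vxx, h1, h2, h3⟩ := exists_jet_relation E.hI E.hJ E.hK E.hL E.hM E.hM0 E.hΦ
    hq.1 hq.2.1 hq.2.2.1 hq.2.2.2.1 hq.2.2.2.2 c a b e k hdet
  simp only [E.fderivT hq, E.fderivX hq, E.fderivU hq, E.fderiv_fderivT hq, E.fderiv_fderivX hq,
    E.fderiv_fderivU hq]
  refine ⟨vt, vx, vxx, h1, fun n₁ n₂ w w₂ hw hw₂ h0 => ?_, h3⟩
  rw [hw₂]
  exact h2 n₁ n₂ w _ hw rfl h0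

/-! ### Necessity: the new time is a function of `t` and `h`. -/

/-- The new time does not depend on `x` and `u` infinitesimally. -/
theorem fderiv_newT_xu (E : IsEquivalenceOnBox Φ I J K L M) {q : ExtPt}
    (hq : q ∈ box I J K L M) : fderiv ℝ (newT Φ) q (0, 1, 0, 0, 0) = 0 ∧
      fderiv ℝ (newT Φ) q (0, 0, 1, 0, 0) = 0 := by
  obtain ⟨t, x, u, h, g⟩ := q
  have hg : g ≠ 0 := fun h0 => E.hM0 (h0 ▸ hq.2.2.2.2)
  have hG := E.newG_ne_zero hq
  have hpre := E.exists_preimage hq 0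
  have hjet := E.jet_relation hq 0
  have eT := apply_ext_basis (fderiv ℝ (newT Φ) (t, x, u, h, g))
  have eX := apply_ext_basis (fderiv ℝ (newX Φ) (t, x, u, h, g))
  have eU := apply_ext_basis (fderiv ℝ (newU Φ) (t, x, u, h, g))
  simp only [smul_eq_mul] at eT eX eU
  generalize fderiv ℝ (newT Φ) (t, x, u, h, g) = DT at *
  generalize fderiv ℝ (newX Φ) (t, x, u, h, g) = DX at *
  generalize fderiv ℝ (newU Φ) (t, x, u, h, g) = DU at *
  -- the Jacobian of the new independent variables
  have claim : ∀ a b : ℝ, DT (1, 0, a, 0, 0) * DX (0, 1, b, 0, 0) -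
      DT (0, 1, b, 0, 0) * DX (1, 0, a, 0, 0) ≠ 0 → DT (0, 1, b, 0, 0) = 0 := by
    intro a b hdet
    by_contra hn
    -- This choice of `u_xx` makes the jet satisfy the old equation.
    have hk : a + u * b + h * u = g * ((a + u * b + h * u) / g) := by field_simp
    -- Two jets are compared that differ only in `u_tt`, `0` or `1`. The old equation does not see
    -- it and the first derivatives of `v` agree, so the new equation, with nonzero `g'`, forces the
    -- same `v_xx`.
    obtain ⟨vt, vx, vxx, p1, p2, p3⟩ := hjet a b 0 _ hdet
    obtain ⟨vt', vx', vxx', p1', p2', p3'⟩ := hjet a b 1 _ hdet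
    have q3 := p3.1 hk
    have q3' := p3'.1 hk
    have a1 := p1 1 0 (1, 0, a, 0, 0) (by simp)
    have a2 := p1 0 1 (0, 1, b, 0, 0) (by simp)
    have a1' := p1' 1 0 (1, 0, a, 0, 0) (by simp)
    have a2' := p1' 0 1 (0, 1, b, 0, 0) (by simp)
    have ht : vt' = vt := sub_eq_zero.1 ((mul_eq_zero.1 (show (vt' - vt) * _ = 0 by
      linear_combination DX (0, 1, b, 0, 0) * (a1 - a1') - DX (1, 0, a, 0, 0) * (a2 - a2'))
      ).resolve_right hdet)
    have hx : vx' = vx := sub_eq_zero.1 ((mul_eq_zero.1 (show (vx' - vx) * _ = 0 by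
      linear_combination DT (1, 0, a, 0, 0) * (a2 - a2') - DT (0, 1, b, 0, 0) * (a1 - a1'))
      ).resolve_right hdet)
    rw [ht, hx] at q3' p2'
    have hxx : vxx' = vxx := mul_left_cancel₀ hG (q3'.symm.trans q3)
    rw [hxx] at p2'
    -- The new time is stationary in the direction `(-D_x T, D_t T)`. The change of `u_tt` enters
    -- the second-order relation there with the factor `(D_x T)²`.
    have hw : DT (-DT (0, 1, b, 0, 0), DT (1, 0, a, 0, 0),
        a * -DT (0, 1, b, 0, 0) + b * DT (1, 0, a, 0, 0), 0, 0 * -DT (0, 1, b, 0, 0)) = 0 := by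
      rw [eT (-DT (0, 1, b, 0, 0)), eT 1 0 a, eT 0 1 b]
      ring
    have s1 := p2 _ _ _ _ rfl rfl hw
    have s2 := p2' _ _ _ _ rfl rfl hw
    rw [eT 0 0 (_ + _), eX 0 0 (_ + _), eU 0 0 (_ + _)] at s1 s2
    have hU : DU (0, 0, 1, 0, 0) = vt * DT (0, 0, 1, 0, 0) + vx * DX (0, 0, 1, 0, 0) := by
      refine mul_left_cancel₀ (pow_ne_zero 2 hn) ?_
      linear_combination s2 - s1
    -- By `hU` and the first-order relations the differential of `U` is a combination of those of
    -- `T` and `X` on the vectors tested, against the nondegeneracy of the point transformation.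
    obtain ⟨n₁, n₂, n₃, m1, m2, m3⟩ := hpre 0 0 1
    rw [eT n₁] at m1
    rw [eX n₁] at m2
    rw [eU n₁] at m3
    rw [eU 1, eT 1, eX 1] at a1
    rw [eU 0 1 b, eT 0 1 b, eX 0 1 b] at a2
    have : (1 : ℝ) = 0 := by
      linear_combination n₁ * a1 + n₂ * a2 + (n₃ - n₁ * a - n₂ * b) * hU + vt * m1 + vx * m2 - m3
    exact one_ne_zero this
  -- Otherwise all `2 × 2` minors of the derivatives of `(T, X)` in `(t, x, u)` vanish, though these
  -- two rows are independent; the jets `(0,0)`, `(1,0)`, `(0,1)` already isolate the minors.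
  obtain ⟨a, b, hab⟩ : ∃ a b : ℝ, DT (1, 0, a, 0, 0) * DX (0, 1, b, 0, 0) -
      DT (0, 1, b, 0, 0) * DX (1, 0, a, 0, 0) ≠ 0 := by
    by_contra! hall
    have d00 := hall 0 0
    have d10 := hall 1 0
    have d01 := hall 0 1
    obtain ⟨n₁, n₂, n₃, m1, m2, -⟩ := hpre 1 0 0
    obtain ⟨l₁, l₂, l₃, k1, k2, -⟩ := hpre 0 1 0
    rw [eT n₁] at m1
    rw [eX n₁] at m2
    rw [eT l₁] at k1
    rw [eX l₁] at k2
    rw [eT 1 0 1, eX 1 0 1] at d10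
    rw [eT 0 1 1, eX 0 1 1] at d01
    generalize DT (1, 0, 0, 0, 0) = T1 at *
    generalize DT (0, 1, 0, 0, 0) = T2 at *
    generalize DT (0, 0, 1, 0, 0) = T3 at *
    generalize DX (1, 0, 0, 0, 0) = X1 at *
    generalize DX (0, 1, 0, 0, 0) = X2 at *
    generalize DX (0, 0, 1, 0, 0) = X3 at *
    have f1 : T1 * X2 - T2 * X1 = 0 := d00
    have f2 : T3 * X2 - T2 * X3 = 0 := by linear_combination d10 - d00
    have f3 : T1 * X3 - T3 * X1 = 0 := by linear_combination d01 - d00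
    have m1' : n₁ * T1 + n₂ * T2 + n₃ * T3 = 1 := by linear_combination m1
    have m2' : n₁ * X1 + n₂ * X2 + n₃ * X3 = 0 := by linear_combination m2
    have k1' : l₁ * T1 + l₂ * T2 + l₃ * T3 = 0 := by linear_combination k1
    have k2' : l₁ * X1 + l₂ * X2 + l₃ * X3 = 1 := by linear_combination k2
    have : (1 : ℝ) = 0 := by
      linear_combination -(l₁ * X1 + l₂ * X2 + l₃ * X3) * m1' - k2'
        + (l₁ * T1 + l₂ * T2 + l₃ * T3) * m2'
        + (n₁ * l₂ - n₂ * l₁) * f1 + (n₃ * l₂ - n₂ * l₃) * f2 + (n₁ * l₃ - n₃ * l₁) * f3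
    exact one_ne_zero this
  -- The determinant is affine in `b`, so zeros at `b + 1` and `b + 2` would force one at `b`. Two
  -- values of `b` then split `T_x + b T_u = 0`.
  obtain ⟨b', hbb', hab'⟩ : ∃ b' : ℝ, b' ≠ b ∧ DT (1, 0, a, 0, 0) * DX (0, 1, b', 0, 0) -
      DT (0, 1, b', 0, 0) * DX (1, 0, a, 0, 0) ≠ 0 := by
    by_contra! hall
    have d1 := hall (b + 1) (by simp)
    have d2 := hall (b + 2) (by simp)
    rw [eT 0 1, eX 0 1] at d1 d2 hab
    exact hab (by linear_combination 2 * d1 - d2)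
  have r1 := claim a b hab
  have r2 := claim a b' hab'
  rw [eT 0 1] at r1 r2
  have r3 : DT (0, 0, 1, 0, 0) = 0 :=
    (mul_eq_zero.1 (show (b' - b) * _ = 0 by linear_combination r2 - r1)).resolve_left
      (sub_ne_zero.2 hbb')
  exact ⟨by rw [r3] at r1; linear_combination r1, r3⟩

/-- For a coefficient of slope `c` the new time has `t`-derivative `T_t + c T_g`. Since `T_x = T_u =
0`, nondegeneracy keeps this nonzero for every real `c`, which is impossible unless `T_g = 0`. -/
theorem fderiv_newT_g (E : IsEquivalenceOnBox Φ I J K L M) {q : ExtPt}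
    (hq : q ∈ box I J K L M) : fderiv ℝ (newT Φ) q (1, 0, 0, 0, 0) ≠ 0 ∧
      fderiv ℝ (newT Φ) q (0, 0, 0, 0, 1) = 0 := by
  obtain ⟨hT2, hT3⟩ := E.fderiv_newT_xu hq
  have eT := apply_ext_basis (fderiv ℝ (newT Φ) q)
  have key : ∀ c : ℝ, fderiv ℝ (newT Φ) q (1, 0, 0, 0, 0) +
      c * fderiv ℝ (newT Φ) q (0, 0, 0, 0, 1) ≠ 0 := fun c h0 => by
    obtain ⟨n₁, n₂, n₃, m1, -, -⟩ := E.exists_preimage hq c 1 0 0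
    rw [eT, hT2, hT3] at m1
    simp only [smul_eq_mul] at m1
    exact one_ne_zero (show (1 : ℝ) = 0 by linear_combination n₁ * h0 - m1)
  refine ⟨by simpa using key 0, ?_⟩
  by_contra hne
  refine key (-(fderiv ℝ (newT Φ) q (1, 0, 0, 0, 0)) / fderiv ℝ (newT Φ) q (0, 0, 0, 0, 1)) ?_
  field_simp
  ring

theorem newT_eq (E : IsEquivalenceOnBox Φ I J K L M) {t x₁ u₁ g₁ x₂ u₂ g₂ h : ℝ}
    (h₁ : (t, x₁, u₁, h, g₁) ∈ box I J K L M) (h₂ : (t, x₂, u₂, h, g₂) ∈ box I J K L M) :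
    newT Φ (t, x₁, u₁, h, g₁) = newT Φ (t, x₂, u₂, h, g₂) := by
  have := shift_eq_of_fderiv_eq_zero E.convex (f := newT Φ)
    (fun q hq => (E.smoothT hq).differentiableAt (by simp))
    (v := (0, x₁ - x₂, u₁ - u₂, 0, g₁ - g₂)) (fun q hq => by
      rw [apply_ext_basis, (E.fderiv_newT_xu hq).1, (E.fderiv_newT_xu hq).2,
        (E.fderiv_newT_g hq).2]
      simp) h₂ (by simpa using h₁)
  simpa using this

theorem newG_eq (E : IsEquivalenceOnBox Φ I J K L M) {t x₁ u₁ x₂ u₂ g h : ℝ}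
    (h₁ : (t, x₁, u₁, h, g) ∈ box I J K L M) (h₂ : (t, x₂, u₂, h, g) ∈ box I J K L M) :
    newG Φ (t, x₁, u₁, h, g) = newG Φ (t, x₂, u₂, h, g) :=
  (E.new_elements h₁ h₂ (.inr rfl)).2 (E.newT_eq h₁ h₂)

/-- A function on the box that is invariant under a shift has equal derivatives at the points
which differ by this shift. -/
theorem fderiv_eq_of_shift (E : IsEquivalenceOnBox Φ I J K L M) {F : Type*} [NormedAddCommGroup F]
    [NormedSpace ℝ F] {f : ExtPt → F} {q v : ExtPt} (hq : q ∈ box I J K L M)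
    (hqv : q + v ∈ box I J K L M)
    (hf : ∀ y ∈ box I J K L M, y + v ∈ box I J K L M → f (y + v) = f y) :
    fderiv ℝ f (q + v) = fderiv ℝ f q := by
  refine fderiv_shift ?_
  have hc : Tendsto (fun y : ExtPt => y + v) (𝓝 q) (𝓝 (q + v)) :=
    (continuous_id.add continuous_const).tendsto q
  filter_upwards [hc.eventually (E.eventually_mem hqv), E.eventually_mem hq] with y hy hy'
  exact hf y hy' hy

theorem fderiv_newT_eq (E : IsEquivalenceOnBox Φ I J K L M) {t x₁ u₁ g₁ x₂ u₂ g₂ h : ℝ}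
    (h₁ : (t, x₁, u₁, h, g₁) ∈ box I J K L M) (h₂ : (t, x₂, u₂, h, g₂) ∈ box I J K L M) :
    fderiv ℝ (newT Φ) (t, x₁, u₁, h, g₁) = fderiv ℝ (newT Φ) (t, x₂, u₂, h, g₂) := by
  have hv : ((t, x₂, u₂, h, g₂) : ExtPt) + (0, x₁ - x₂, u₁ - u₂, 0, g₁ - g₂) =
    (t, x₁, u₁, h, g₁) := by simp
  rw [← hv] at h₁ ⊢
  refine E.fderiv_eq_of_shift h₂ h₁ fun y hy hy' => ?_
  obtain ⟨s, x, u, k, g⟩ := y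
  simp only [Prod.mk_add_mk, add_zero] at hy' ⊢
  exact E.newT_eq hy' hy

/-- The second derivative of the new time along `x` and `u`. -/
theorem fderiv_fderiv_newT (E : IsEquivalenceOnBox Φ I J K L M) {q : ExtPt}
    (hq : q ∈ box I J K L M) (w : ExtPt) (b : ℝ) :
    fderiv ℝ (fderiv ℝ (newT Φ)) q w (0, 1, b, 0, 0) = 0 := by
  have h1 : (fun y => fderiv ℝ (newT Φ) y (0, 1, b, 0, 0)) =ᶠ[𝓝 q] fun _ => 0 := by
    filter_upwards [E.eventually_mem hq] with y hy
    rw [apply_ext_basis, (E.fderiv_newT_xu hy).1, (E.fderiv_newT_xu hy).2]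
    simp
  rw [← fderiv_fderiv_apply (E.smoothT hq), h1.fderiv_eq]
  simp

/-! ### Necessity: splitting the transformed equation with respect to the free jets. -/

/-- The equation in the new variables in terms of the derivatives of the old dependent variable. -/
theorem equation_along_x (E : IsEquivalenceOnBox Φ I J K L M) {t x u h g : ℝ}
    (hq : (t, x, u, h, g) ∈ box I J K L M) (c b k Y p : ℝ)
    (hY : Y = fderiv ℝ (newX Φ) (t, x, u, h, g) (0, 1, b, 0, 0)) (hY0 : Y ≠ 0)
    (hp : p * Y = fderiv ℝ (newU Φ) (t, x, u, h, g) (0, 1, b, 0, 0)) :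
    Y ^ 2 * (fderiv ℝ (newU Φ) (t, x, u, h, g) (1, 0, g * k - u * b - h * u, 0, c)
        - p * fderiv ℝ (newX Φ) (t, x, u, h, g) (1, 0, g * k - u * b - h * u, 0, c)
        + fderiv ℝ (newT Φ) (t, x, u, h, g) (1, 0, 0, 0, 0) *
          (newU Φ (t, x, u, h, g) * p + newH Φ (t, x, u, h, g) * newU Φ (t, x, u, h, g))) =
      fderiv ℝ (newT Φ) (t, x, u, h, g) (1, 0, 0, 0, 0) * newG Φ (t, x, u, h, g) *
        (fderiv ℝ (fderiv ℝ (newU Φ)) (t, x, u, h, g) (0, 1, b, 0, 0) (0, 1, b, 0, 0)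
          + k * fderiv ℝ (newU Φ) (t, x, u, h, g) (0, 0, 1, 0, 0)
          - p * (fderiv ℝ (fderiv ℝ (newX Φ)) (t, x, u, h, g) (0, 1, b, 0, 0) (0, 1, b, 0, 0)
            + k * fderiv ℝ (newX Φ) (t, x, u, h, g) (0, 0, 1, 0, 0))) := by
  obtain ⟨hT2, hT3⟩ := E.fderiv_newT_xu hq
  obtain ⟨hT1, hT5⟩ := E.fderiv_newT_g hq
  have hTT := E.fderiv_fderiv_newT hq (0, 1, b, 0, 0) b
  -- The value of `u_t` is solved from the old equation, so `c`, `u_x = b` and `u_xx = k` stay free;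
  -- `u_tt` is irrelevant and set to `0`.
  have hjet := E.jet_relation hq c (g * k - u * b - h * u) b 0 k
  have eT := apply_ext_basis (fderiv ℝ (newT Φ) (t, x, u, h, g))
  have eX := apply_ext_basis (fderiv ℝ (newX Φ) (t, x, u, h, g))
  have eU := apply_ext_basis (fderiv ℝ (newU Φ) (t, x, u, h, g))
  simp only [smul_eq_mul] at eT eX eU
  generalize fderiv ℝ (newT Φ) (t, x, u, h, g) = DT at *
  generalize fderiv ℝ (newX Φ) (t, x, u, h, g) = DX at *
  generalize fderiv ℝ (newU Φ) (t, x, u, h, g) = DU at *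
  have hTa : DT (1, 0, g * k - u * b - h * u, 0, c) = DT (1, 0, 0, 0, 0) := by
    rw [eT 1 0 (g * k - u * b - h * u), hT2, hT3, hT5]; ring
  have hTb : DT (0, 1, b, 0, 0) = 0 := by
    rw [eT 0 1 b, hT2, hT3]; ring
  rw [hTa, hTb, ← hY] at hjet
  obtain ⟨vt, vx, vxx, h1, h2, h3⟩ := hjet (by simpa using mul_ne_zero hT1 hY0)
  have h3 := h3.1 (by ring)
  have a1 := h1 1 0 (1, 0, g * k - u * b - h * u, 0, c) (by simp)
  have a2 := h1 0 1 (0, 1, b, 0, 0) (by simp)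
  have a3 := h2 0 1 (0, 1, b, 0, 0) (0, 0, k, 0, 0) (by simp) (by simp) hTb
  rw [hTa] at a1
  rw [hTb, ← hY, ← hp] at a2
  rw [hTT, ← hY, eT 0 0 k, eX 0 0 k, eU 0 0 k, hT2, hT3] at a3
  have hvx : vx = p := mul_right_cancel₀ hY0 (by linear_combination -a2)
  subst hvx
  generalize DT (1, 0, 0, 0, 0) = T1 at *
  linear_combination Y ^ 2 * a1 + Y ^ 2 * T1 * h3 - T1 * newG Φ (t, x, u, h, g) * a3

/-- The derivatives of the new `x` and of the new `u` with respect to `(x, u)` are linearly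
independent. -/
theorem fibre_independent (E : IsEquivalenceOnBox Φ I J K L M) {q : ExtPt}
    (hq : q ∈ box I J K L M) (r s : ℝ)
    (h2 : r * fderiv ℝ (newX Φ) q (0, 1, 0, 0, 0) + s * fderiv ℝ (newU Φ) q (0, 1, 0, 0, 0) = 0)
    (h3 : r * fderiv ℝ (newX Φ) q (0, 0, 1, 0, 0) + s * fderiv ℝ (newU Φ) q (0, 0, 1, 0, 0) = 0) :
    r = 0 ∧ s = 0 := by
  obtain ⟨hT2, hT3⟩ := E.fderiv_newT_xu hq
  obtain ⟨hT1, hT5⟩ := E.fderiv_newT_g hq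
  have key : ∀ a b : ℝ, r * a + s * b = 0 := fun a b => by
    obtain ⟨n₁, n₂, n₃, m1, m2, m3⟩ := E.exists_preimage hq 0 0 a b
    rw [apply_ext_basis, hT2, hT3] at m1
    have hn : n₁ = 0 := by simpa [hT1] using m1
    rw [apply_ext_basis, hn] at m2 m3
    simp only [smul_eq_mul] at m2 m3
    linear_combination -r * m2 - s * m3 + n₂ * h2 + n₃ * h3
  exact ⟨by simpa using key 1 0, by simpa using key 0 1⟩

/-- This is the coefficient of `u_xx`, obtained by subtracting the cases `k = 0` and `k = 1`. The
common factor `U_u - p X_u` is nonzero by `fibre_independent`. -/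
theorem newX_characteristic (E : IsEquivalenceOnBox Φ I J K L M) {t x u h g : ℝ}
    (hq : (t, x, u, h, g) ∈ box I J K L M) (b : ℝ)
    (hY0 : fderiv ℝ (newX Φ) (t, x, u, h, g) (0, 1, b, 0, 0) ≠ 0) :
    g * fderiv ℝ (newX Φ) (t, x, u, h, g) (0, 1, b, 0, 0) ^ 2 =
      fderiv ℝ (newT Φ) (t, x, u, h, g) (1, 0, 0, 0, 0) * newG Φ (t, x, u, h, g) := by
  have h0 := E.equation_along_x hq 0 b 0 _ _ rfl hY0 (div_mul_cancel₀ _ hY0)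
  have h1 := E.equation_along_x hq 0 b 1 _ _ rfl hY0 (div_mul_cancel₀ _ hY0)
  have eX := apply_ext_basis (fderiv ℝ (newX Φ) (t, x, u, h, g))
  have eU := apply_ext_basis (fderiv ℝ (newU Φ) (t, x, u, h, g))
  have hW := E.fibre_independent hq (-(fderiv ℝ (newU Φ) (t, x, u, h, g) (0, 1, b, 0, 0) /
    fderiv ℝ (newX Φ) (t, x, u, h, g) (0, 1, b, 0, 0))) 1
  have hp := div_mul_cancel₀ (fderiv ℝ (newU Φ) (t, x, u, h, g) (0, 1, b, 0, 0)) hY0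
  simp only [smul_eq_mul] at eX eU
  generalize fderiv ℝ (newU Φ) (t, x, u, h, g) (0, 1, b, 0, 0) /
    fderiv ℝ (newX Φ) (t, x, u, h, g) (0, 1, b, 0, 0) = p at *
  generalize fderiv ℝ (newX Φ) (t, x, u, h, g) = DX at *
  generalize fderiv ℝ (newU Φ) (t, x, u, h, g) = DU at *
  have hW' : DU (0, 0, 1, 0, 0) - p * DX (0, 0, 1, 0, 0) ≠ 0 := fun hW0 => by
    refine one_ne_zero (hW ?_ ?_).2
    · rw [eX 0 1 b, eU 0 1 b] at hp
      linear_combination -hp - b * hW0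
    · linear_combination hW0
  rw [eX 1, eU 1] at h0 h1
  refine mul_left_cancel₀ hW' ?_
  linear_combination h1 - h0

/-- The right side of `newX_characteristic` is free of `b`. If `X_u ≠ 0`, suitable `b` give `X_x + b
X_u` the values `1` and `2`, whence `g = 4 g`. -/
theorem newX_u (E : IsEquivalenceOnBox Φ I J K L M) {q : ExtPt} (hq : q ∈ box I J K L M) :
    fderiv ℝ (newX Φ) q (0, 0, 1, 0, 0) = 0 ∧ fderiv ℝ (newX Φ) q (0, 1, 0, 0, 0) ≠ 0 := by
  obtain ⟨t, x, u, h, g⟩ := q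
  have hg : g ≠ 0 := fun h0 => E.hM0 (h0 ▸ hq.2.2.2.2)
  have hch := E.newX_characteristic hq
  have eX := apply_ext_basis (fderiv ℝ (newX Φ) (t, x, u, h, g))
  have hW := E.fibre_independent hq 1 0
  simp only [smul_eq_mul] at eX
  generalize fderiv ℝ (newX Φ) (t, x, u, h, g) = DX at *
  have h3 : DX (0, 0, 1, 0, 0) = 0 := by
    by_contra hne
    have e : ∀ r : ℝ, DX (0, 1, (r - DX (0, 1, 0, 0, 0)) / DX (0, 0, 1, 0, 0), 0, 0) = r :=
      fun r => by
        rw [eX 0 1 (_ / _), div_mul_cancel₀ _ hne]; ring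
    have c1 := hch _ (by rw [e 1]; exact one_ne_zero)
    have c2 := hch _ (by rw [e 2]; exact two_ne_zero)
    rw [e] at c1 c2
    exact hg (by linear_combination (c2 - c1) / 3)
  refine ⟨h3, fun h2 => one_ne_zero (hW ?_ ?_).1⟩
  · rw [h2]; ring
  · rw [h3]; ring

theorem newU_u_ne_zero (E : IsEquivalenceOnBox Φ I J K L M) {q : ExtPt} (hq : q ∈ box I J K L M) :
    fderiv ℝ (newU Φ) q (0, 0, 1, 0, 0) ≠ 0 := fun h0 => by
  obtain ⟨h3, h2⟩ := E.newX_u hq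
  refine h2 (E.fibre_independent hq (-fderiv ℝ (newU Φ) q (0, 1, 0, 0, 0))
    (fderiv ℝ (newX Φ) q (0, 1, 0, 0, 0)) (by ring) ?_).2
  rw [h3, h0]; ring

/-- Now `g X_x² = T_t g'` holds with a right side independent of `x` and `u`. Differentiating it and
using `X_x ≠ 0` gives `X_xx = 0`, while derivatives of `X_u` vanish identically. -/
theorem fderiv_fderiv_newX (E : IsEquivalenceOnBox Φ I J K L M) {q : ExtPt}
    (hq : q ∈ box I J K L M) (b : ℝ) :
    fderiv ℝ (fderiv ℝ (newX Φ)) q (0, 1, b, 0, 0) (0, 1, 0, 0, 0) = 0 ∧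
    fderiv ℝ (fderiv ℝ (newX Φ)) q (0, 1, b, 0, 0) (0, 1, b, 0, 0) = 0 := by
  have h3 : fderiv ℝ (fderiv ℝ (newX Φ)) q (0, 1, b, 0, 0) (0, 0, 1, 0, 0) = 0 := by
    have h1 : (fun y => fderiv ℝ (newX Φ) y (0, 0, 1, 0, 0)) =ᶠ[𝓝 q] fun _ => 0 := by
      filter_upwards [E.eventually_mem hq] with y hy using (E.newX_u hy).1
    rw [← fderiv_fderiv_apply (E.smoothX hq), h1.fderiv_eq]
    simp
  have h2 : fderiv ℝ (fderiv ℝ (newX Φ)) q (0, 1, b, 0, 0) (0, 1, 0, 0, 0) = 0 := by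
    have hne := (E.newX_u hq).2
    have hd : DifferentiableAt ℝ (fun y => fderiv ℝ (newX Φ) y (0, 1, 0, 0, 0)) q :=
      ((((E.smoothX hq).fderiv_right (m := 1) (by norm_cast)).differentiableAt
        one_ne_zero).hasFDerivAt.clm_apply (hasFDerivAt_const _ q)).differentiableAt
    have hl : HasDerivAt (fun s : ℝ => fderiv ℝ (newX Φ) (q + s • (0, 1, b, 0, 0)) (0, 1, 0, 0, 0))
        (fderiv ℝ (fderiv ℝ (newX Φ)) q (0, 1, b, 0, 0) (0, 1, 0, 0, 0)) 0 := by
      rw [← fderiv_fderiv_apply (E.smoothX hq)]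
      exact hd.hasFDerivAt.hasLineDerivAt _
    obtain ⟨t, x, u, h, g⟩ := q
    have hg : g ≠ 0 := fun h0 => E.hM0 (h0 ▸ hq.2.2.2.2)
    have hc : Tendsto (fun s : ℝ => ((t, x, u, h, g) : ExtPt) + s • (0, 1, b, 0, 0)) (𝓝 0)
        (𝓝 (t, x, u, h, g)) := by
      have : ContinuousAt (fun s : ℝ => ((t, x, u, h, g) : ExtPt) + s • (0, 1, b, 0, 0)) 0 := by
        fun_prop
      simpa using this.tendsto
    have hconst : (fun s : ℝ => g * fderiv ℝ (newX Φ) ((t, x, u, h, g) + s • (0, 1, b, 0, 0))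
        (0, 1, 0, 0, 0) ^ 2) =ᶠ[𝓝 0] fun _ =>
          fderiv ℝ (newT Φ) (t, x, u, h, g) (1, 0, 0, 0, 0) * newG Φ (t, x, u, h, g) := by
      filter_upwards [hc.eventually (E.eventually_mem hq)] with s hs
      simp only [Prod.smul_mk, smul_eq_mul, mul_zero, mul_one, Prod.mk_add_mk, add_zero] at hs ⊢
      rw [E.newX_characteristic hs 0 (E.newX_u hs).2, E.fderiv_newT_eq hs hq, E.newG_eq hs hq]
    have h4 := ((hl.pow 2).const_mul g).unique
      ((hasDerivAt_const (0 : ℝ) _).congr_of_eventuallyEq hconst)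
    simpa [hg, hne] using h4
  refine ⟨h2, ?_⟩
  have := apply_ext_basis (fderiv ℝ (fderiv ℝ (newX Φ)) q (0, 1, b, 0, 0)) 0 1 b 0 0
  rw [this, h2, h3]
  simp

/-- What remains of `equation_along_x` at `k = 0` once `X_u = X_xx = 0` and `T_t g' = g X_x²` are
inserted and `X_x²` is cancelled. It holds for all `b` and `c`, which are split next. -/
theorem reduced_equation (E : IsEquivalenceOnBox Φ I J K L M) {t x u h g : ℝ}
    (hq : (t, x, u, h, g) ∈ box I J K L M) (c b : ℝ) :
    fderiv ℝ (newX Φ) (t, x, u, h, g) (0, 1, 0, 0, 0) *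
        (fderiv ℝ (newU Φ) (t, x, u, h, g) (1, 0, 0, 0, 0) +
          c * fderiv ℝ (newU Φ) (t, x, u, h, g) (0, 0, 0, 0, 1) -
          (u * b + h * u) * fderiv ℝ (newU Φ) (t, x, u, h, g) (0, 0, 1, 0, 0)) -
      (fderiv ℝ (newU Φ) (t, x, u, h, g) (0, 1, 0, 0, 0) +
          b * fderiv ℝ (newU Φ) (t, x, u, h, g) (0, 0, 1, 0, 0)) *
        (fderiv ℝ (newX Φ) (t, x, u, h, g) (1, 0, 0, 0, 0) +
          c * fderiv ℝ (newX Φ) (t, x, u, h, g) (0, 0, 0, 0, 1)) +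
      fderiv ℝ (newT Φ) (t, x, u, h, g) (1, 0, 0, 0, 0) * newU Φ (t, x, u, h, g) *
        (fderiv ℝ (newU Φ) (t, x, u, h, g) (0, 1, 0, 0, 0) +
          b * fderiv ℝ (newU Φ) (t, x, u, h, g) (0, 0, 1, 0, 0) +
          fderiv ℝ (newX Φ) (t, x, u, h, g) (0, 1, 0, 0, 0) * newH Φ (t, x, u, h, g)) =
      g * (fderiv ℝ (newX Φ) (t, x, u, h, g) (0, 1, 0, 0, 0) *
        fderiv ℝ (fderiv ℝ (newU Φ)) (t, x, u, h, g) (0, 1, b, 0, 0) (0, 1, b, 0, 0)) := by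
  obtain ⟨hX3, hX2⟩ := E.newX_u hq
  have hXX := (E.fderiv_fderiv_newX hq b).2
  have eX := apply_ext_basis (fderiv ℝ (newX Φ) (t, x, u, h, g))
  have eU := apply_ext_basis (fderiv ℝ (newU Φ) (t, x, u, h, g))
  have hch := E.newX_characteristic hq 0 hX2
  have hm := E.equation_along_x hq c b 0 (fderiv ℝ (newX Φ) (t, x, u, h, g) (0, 1, 0, 0, 0))
    (fderiv ℝ (newU Φ) (t, x, u, h, g) (0, 1, b, 0, 0) /
      fderiv ℝ (newX Φ) (t, x, u, h, g) (0, 1, 0, 0, 0)) (by rw [eX 0 1 b, hX3]; simp) hX2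
    (div_mul_cancel₀ _ hX2)
  have hp := div_mul_cancel₀ (fderiv ℝ (newU Φ) (t, x, u, h, g) (0, 1, b, 0, 0)) hX2
  simp only [smul_eq_mul] at eX eU
  generalize fderiv ℝ (newU Φ) (t, x, u, h, g) (0, 1, b, 0, 0) /
    fderiv ℝ (newX Φ) (t, x, u, h, g) (0, 1, 0, 0, 0) = p at *
  rw [eU 0 1 b] at hp
  rw [hXX, eX 1 0 (_ - _), eU 1 0 (_ - _), hX3] at hm
  generalize fderiv ℝ (newX Φ) (t, x, u, h, g) (0, 1, 0, 0, 0) = X2 at *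
  refine mul_left_cancel₀ (pow_ne_zero 2 hX2) ?_
  linear_combination X2 * hm - X2 * fderiv ℝ (fderiv ℝ (newU Φ)) (t, x, u, h, g)
    (0, 1, b, 0, 0) (0, 1, b, 0, 0) * hch + X2 ^ 2 *
      (fderiv ℝ (newX Φ) (t, x, u, h, g) (1, 0, 0, 0, 0) +
        c * fderiv ℝ (newX Φ) (t, x, u, h, g) (0, 0, 0, 0, 1)
        - fderiv ℝ (newT Φ) (t, x, u, h, g) (1, 0, 0, 0, 0) * newU Φ (t, x, u, h, g)) * hp

/-- The coefficient of `b c` in `reduced_equation` is `-U_u X_g`, which gives `X_g = 0`; then the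
coefficient of `c` is `X_x U_g`. -/
theorem fderiv_g (E : IsEquivalenceOnBox Φ I J K L M) {q : ExtPt} (hq : q ∈ box I J K L M) :
    fderiv ℝ (newX Φ) q (0, 0, 0, 0, 1) = 0 ∧ fderiv ℝ (newU Φ) q (0, 0, 0, 0, 1) = 0 := by
  obtain ⟨t, x, u, h, g⟩ := q
  have hX2 := (E.newX_u hq).2
  have hU3 := E.newU_u_ne_zero hq
  have h00 := E.reduced_equation hq 0 0
  have h10 := E.reduced_equation hq 1 0
  have h01 := E.reduced_equation hq 0 1
  have h11 := E.reduced_equation hq 1 1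
  have hX5 : fderiv ℝ (newX Φ) (t, x, u, h, g) (0, 0, 0, 0, 1) = 0 := by
    refine mul_left_cancel₀ hU3 ?_
    linear_combination h10 - h00 - h11 + h01
  refine ⟨hX5, mul_left_cancel₀ hX2 ?_⟩
  rw [hX5] at h10 h00
  linear_combination h10 - h00

theorem newX_eq_g (E : IsEquivalenceOnBox Φ I J K L M) {t x u h g₁ g₂ : ℝ}
    (h₁ : (t, x, u, h, g₁) ∈ box I J K L M) (h₂ : (t, x, u, h, g₂) ∈ box I J K L M) :
    newX Φ (t, x, u, h, g₁) = newX Φ (t, x, u, h, g₂) ∧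
    newU Φ (t, x, u, h, g₁) = newU Φ (t, x, u, h, g₂) := by
  have hv : ((t, x, u, h, g₂) : ExtPt) + (0, 0, 0, 0, g₁ - g₂) = (t, x, u, h, g₁) := by simp
  rw [← hv] at h₁ ⊢
  constructor
  · refine shift_eq_of_fderiv_eq_zero E.convex
      (fun q hq => (E.smoothX hq).differentiableAt (by simp)) (fun q hq => ?_) h₂ h₁
    rw [apply_ext_basis, (E.fderiv_g hq).1]; simp
  · refine shift_eq_of_fderiv_eq_zero E.convex
      (fun q hq => (E.smoothU hq).differentiableAt (by simp)) (fun q hq => ?_) h₂ h₁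
    rw [apply_ext_basis, (E.fderiv_g hq).2]; simp

theorem fderiv_eq_g (E : IsEquivalenceOnBox Φ I J K L M) {t x u h g₁ g₂ : ℝ}
    (h₁ : (t, x, u, h, g₁) ∈ box I J K L M) (h₂ : (t, x, u, h, g₂) ∈ box I J K L M) :
    fderiv ℝ (newX Φ) (t, x, u, h, g₁) = fderiv ℝ (newX Φ) (t, x, u, h, g₂) ∧
    fderiv ℝ (newU Φ) (t, x, u, h, g₁) = fderiv ℝ (newU Φ) (t, x, u, h, g₂) ∧
    fderiv ℝ (fderiv ℝ (newU Φ)) (t, x, u, h, g₁) =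
      fderiv ℝ (fderiv ℝ (newU Φ)) (t, x, u, h, g₂) := by
  have hv : ((t, x, u, h, g₂) : ExtPt) + (0, 0, 0, 0, g₁ - g₂) = (t, x, u, h, g₁) := by simp
  rw [← hv] at h₁ ⊢
  have hsh : ∀ y : ExtPt, y + (0, 0, 0, 0, g₁ - g₂) =
      (y.1, y.2.1, y.2.2.1, y.2.2.2.1, y.2.2.2.2 + (g₁ - g₂)) := fun y => by
    obtain ⟨s, x, u, k, g⟩ := y; simp
  have hU : ∀ y ∈ box I J K L M, y + (0, 0, 0, 0, g₁ - g₂) ∈ box I J K L M →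
      fderiv ℝ (newU Φ) (y + (0, 0, 0, 0, g₁ - g₂)) = fderiv ℝ (newU Φ) y := fun y hy hy' =>
    E.fderiv_eq_of_shift hy hy' fun z hz hz' => by
      rw [hsh] at hz' ⊢
      exact (E.newX_eq_g hz' hz).2
  refine ⟨E.fderiv_eq_of_shift h₂ h₁ fun z hz hz' => ?_, hU _ h₂ h₁, E.fderiv_eq_of_shift h₂ h₁ hU⟩
  rw [hsh] at hz' ⊢
  exact (E.newX_eq_g hz' hz).1

/-- The new `u` is determined by the new `t` and `x`; it satisfies a linear equation. -/
theorem newU_equations (E : IsEquivalenceOnBox Φ I J K L M) {t x u h g : ℝ}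
    (hq : (t, x, u, h, g) ∈ box I J K L M) :
    fderiv ℝ (newT Φ) (t, x, u, h, g) (1, 0, 0, 0, 0) * newU Φ (t, x, u, h, g) =
      fderiv ℝ (newX Φ) (t, x, u, h, g) (0, 1, 0, 0, 0) * u +
        fderiv ℝ (newX Φ) (t, x, u, h, g) (1, 0, 0, 0, 0) ∧
    fderiv ℝ (newU Φ) (t, x, u, h, g) (1, 0, 0, 0, 0) +
        u * fderiv ℝ (newU Φ) (t, x, u, h, g) (0, 1, 0, 0, 0) -
        h * u * fderiv ℝ (newU Φ) (t, x, u, h, g) (0, 0, 1, 0, 0) +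
        newH Φ (t, x, u, h, g) * (fderiv ℝ (newX Φ) (t, x, u, h, g) (0, 1, 0, 0, 0) * u +
          fderiv ℝ (newX Φ) (t, x, u, h, g) (1, 0, 0, 0, 0)) = 0 := by
  have hX2 := (E.newX_u hq).2
  have hU3 := E.newU_u_ne_zero hq
  obtain ⟨g', hg', hne⟩ := E.hM.exists_ne hq.2.2.2.2
  have hq' : (t, x, u, h, g') ∈ box I J K L M := ⟨hq.1, hq.2.1, hq.2.2.1, hq.2.2.2.1, hg'⟩
  -- Nothing in `reduced_equation` depends on `g` any more except the explicit factor on the right,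
  -- so two values of `g` force the right side to vanish.
  have hzero : ∀ b : ℝ, fderiv ℝ (newX Φ) (t, x, u, h, g) (0, 1, 0, 0, 0) *
      fderiv ℝ (fderiv ℝ (newU Φ)) (t, x, u, h, g) (0, 1, b, 0, 0) (0, 1, b, 0, 0) = 0 := fun b => by
    have e1 := E.reduced_equation hq 0 b
    have e2 := E.reduced_equation hq' 0 b
    rw [(E.fderiv_eq_g hq' hq).1, (E.fderiv_eq_g hq' hq).2.1, (E.fderiv_eq_g hq' hq).2.2,
      (E.newX_eq_g hq' hq).2, E.newH_eq hq' hq, E.fderiv_newT_eq hq' hq] at e2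
    exact (mul_eq_zero.1 (show (g' - g) * _ = 0 by linear_combination e1 - e2)).resolve_left
      (sub_ne_zero.2 hne)
  have e0 := E.reduced_equation hq 0 0
  have e1 := E.reduced_equation hq 0 1
  rw [hzero] at e0 e1
  have hA : fderiv ℝ (newT Φ) (t, x, u, h, g) (1, 0, 0, 0, 0) * newU Φ (t, x, u, h, g) =
      fderiv ℝ (newX Φ) (t, x, u, h, g) (0, 1, 0, 0, 0) * u +
        fderiv ℝ (newX Φ) (t, x, u, h, g) (1, 0, 0, 0, 0) := by
    -- The coefficient of `b`, which carries the factor `U_u`.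
    refine mul_left_cancel₀ hU3 ?_
    linear_combination e1 - e0
  refine ⟨hA, mul_left_cancel₀ hX2 ?_⟩
  rw [hA] at e0
  linear_combination e0

end IsEquivalenceOnBox

/-! ### Necessity: affine form of the components and the determining system. -/

theorem hasDerivAt_slice_t {f : ExtPt → ℝ} {t x u h g : ℝ}
    (hf : DifferentiableAt ℝ f (t, x, u, h, g)) :
    HasDerivAt (fun s => f (s, x, u, h, g)) (fderiv ℝ f (t, x, u, h, g) (1, 0, 0, 0, 0)) t := by
  have h1 : HasDerivAt (fun s : ℝ => ((s, x, u, h, g) : ExtPt)) (1, 0, 0, 0, 0) t :=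
    (hasDerivAt_id' t).prodMk (hasDerivAt_const t _)
  exact hf.hasFDerivAt.comp_hasDerivAt t h1

theorem hasDerivAt_slice_x {f : ExtPt → ℝ} {t x u h g : ℝ}
    (hf : DifferentiableAt ℝ f (t, x, u, h, g)) :
    HasDerivAt (fun s => f (t, s, u, h, g)) (fderiv ℝ f (t, x, u, h, g) (0, 1, 0, 0, 0)) x := by
  have h1 : HasDerivAt (fun s : ℝ => ((t, s, u, h, g) : ExtPt)) (0, 1, 0, 0, 0) x :=
    (hasDerivAt_const x _).prodMk ((hasDerivAt_id' x).prodMk (hasDerivAt_const x _))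
  exact hf.hasFDerivAt.comp_hasDerivAt x h1

theorem hasDerivAt_slice_u {f : ExtPt → ℝ} {t x u h g : ℝ}
    (hf : DifferentiableAt ℝ f (t, x, u, h, g)) :
    HasDerivAt (fun s => f (t, x, s, h, g)) (fderiv ℝ f (t, x, u, h, g) (0, 0, 1, 0, 0)) u := by
  have h1 : HasDerivAt (fun s : ℝ => ((t, x, s, h, g) : ExtPt)) (0, 0, 1, 0, 0) u :=
    (hasDerivAt_const u _).prodMk ((hasDerivAt_const u _).prodMk
      ((hasDerivAt_id' u).prodMk (hasDerivAt_const u _)))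
  exact hf.hasFDerivAt.comp_hasDerivAt u h1

theorem differentiableAt_fderiv_apply {f : ExtPt → ℝ} {q : ExtPt} (hf : ContDiffAt ℝ ∞ f q)
    (v : ExtPt) : DifferentiableAt ℝ (fun y => fderiv ℝ f y v) q :=
  (((hf.fderiv_right (m := 1) (by norm_cast)).differentiableAt
    one_ne_zero).hasFDerivAt.clm_apply (hasFDerivAt_const v q)).differentiableAt

/-- An affine function that vanishes on a product of open intervals has zero coefficients. -/
theorem affine_coeff_eq_zero {J K : Set ℝ} (hJ : IsOpenInterval J) (hK : IsOpenInterval K)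
    {a b c : ℝ} (h : ∀ x ∈ J, ∀ u ∈ K, a * u + b * x + c = 0) : a = 0 ∧ b = 0 ∧ c = 0 := by
  obtain ⟨x₀, hx₀⟩ := hJ.nonempty
  obtain ⟨u₀, hu₀⟩ := hK.nonempty
  obtain ⟨x₁, hx₁, hx⟩ := hJ.exists_ne hx₀
  obtain ⟨u₁, hu₁, hu⟩ := hK.exists_ne hu₀
  have h0 := h x₀ hx₀ u₀ hu₀
  have h1 := h x₁ hx₁ u₀ hu₀
  have h2 := h x₀ hx₀ u₁ hu₁
  have hb : b = 0 := (mul_eq_zero.1 (show b * (x₁ - x₀) = 0 by linear_combination h1 - h0)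
    ).resolve_right (sub_ne_zero.2 hx)
  have ha : a = 0 := (mul_eq_zero.1 (show a * (u₁ - u₀) = 0 by linear_combination h2 - h0)
    ).resolve_right (sub_ne_zero.2 hu)
  exact ⟨ha, hb, by simpa [ha, hb] using h0⟩

namespace IsEquivalenceOnBox

variable {Φ : ExtPt → ExtPt} {I J K L M : Set ℝ}

theorem diffT (E : IsEquivalenceOnBox Φ I J K L M) {q : ExtPt} (hq : q ∈ box I J K L M) :
    DifferentiableAt ℝ (newT Φ) q := (E.smoothT hq).differentiableAt (by simp)

theorem diffX (E : IsEquivalenceOnBox Φ I J K L M) {q : ExtPt} (hq : q ∈ box I J K L M) :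
    DifferentiableAt ℝ (newX Φ) q := (E.smoothX hq).differentiableAt (by simp)

theorem diffU (E : IsEquivalenceOnBox Φ I J K L M) {q : ExtPt} (hq : q ∈ box I J K L M) :
    DifferentiableAt ℝ (newU Φ) q := (E.smoothU hq).differentiableAt (by simp)

theorem newX_affine (E : IsEquivalenceOnBox Φ I J K L M) {t x u g x₀ u₀ g₀ h : ℝ}
    (h₁ : (t, x, u, h, g) ∈ box I J K L M) (h₀ : (t, x₀, u₀, h, g₀) ∈ box I J K L M) :
    newX Φ (t, x, u, h, g) = fderiv ℝ (newX Φ) (t, x₀, u₀, h, g₀) (0, 1, 0, 0, 0) * x +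
      (newX Φ (t, x₀, u₀, h, g₀) -
        fderiv ℝ (newX Φ) (t, x₀, u₀, h, g₀) (0, 1, 0, 0, 0) * x₀) := by
  have h₂ : (t, x, u₀, h, g₀) ∈ box I J K L M :=
    ⟨h₁.1, h₁.2.1, h₀.2.2.1, h₀.2.2.2.1, h₀.2.2.2.2⟩
  have e1 : newX Φ (t, x, u, h, g) = newX Φ (t, x, u₀, h, g₀) := by
    have := shift_eq_of_fderiv_eq_zero E.convex (fun q hq => E.diffX hq)
      (v := (0, 0, u - u₀, 0, g - g₀)) (fun q hq => by
        rw [apply_ext_basis, (E.fderiv_g hq).1, (E.newX_u hq).1]; simp) h₂ (by simpa using h₁)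
    simpa using this
  have hXX : ∀ (a : ℝ), ∀ q ∈ box I J K L M,
      fderiv ℝ (fun y => fderiv ℝ (newX Φ) y (0, 1, 0, 0, 0)) q (0, a, 0, 0, 0) = 0 :=
    fun a q hq => by
      rw [apply_ext_basis, fderiv_fderiv_apply (E.smoothX hq) _ (0, 1, 0, 0, 0),
        (E.fderiv_fderiv_newX hq 0).1]
      simp
  have e2 := shift_eq_of_fderiv_eq_zero E.convex
    (fun q hq => differentiableAt_fderiv_apply (E.smoothX hq) (0, 1, 0, 0, 0))
    (hXX (x - x₀)) h₀ (by simpa using h₂)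
  -- As `X_x` is constant along `x`, so is `X - x X_x`.
  have e3 := shift_eq_of_fderiv_eq_zero E.convex
    (f := fun y => newX Φ y - fderiv ℝ (newX Φ) y (0, 1, 0, 0, 0) * y.2.1)
    (v := (0, x - x₀, 0, 0, 0))
    (fun q hq => (E.diffX hq).sub ((differentiableAt_fderiv_apply (E.smoothX hq) _).mul
      (by fun_prop))) (fun q hq => by
        have h1 : HasFDerivAt (fun y : ExtPt => y.2.1)
          (ContinuousLinearMap.fst ℝ ℝ _ ∘L ContinuousLinearMap.snd ℝ ℝ _) q :=
          (ContinuousLinearMap.fst ℝ ℝ (ℝ × ℝ × ℝ) ∘L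
            ContinuousLinearMap.snd ℝ ℝ (ℝ × ℝ × ℝ × ℝ)).hasFDerivAt
        have h2 := (E.diffX hq).hasFDerivAt.fun_sub
          ((differentiableAt_fderiv_apply (E.smoothX hq) (0, 1, 0, 0, 0)).hasFDerivAt.fun_mul h1)
        rw [h2.fderiv]
        simp only [sub_apply, add_apply, smul_apply, ContinuousLinearMap.comp_apply,
          ContinuousLinearMap.coe_fst', ContinuousLinearMap.coe_snd', smul_eq_mul]
        rw [hXX _ q hq, apply_ext_basis (fderiv ℝ (newX Φ) q)]
        simp
        ring)
    h₀ (by simpa using h₂)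
  simp only [Prod.mk_add_mk, add_zero, add_sub_cancel] at e2 e3
  rw [e2] at e3
  rw [e1]
  linear_combination e3

/-- `X` is affine in `x`, so `T_t U = X_x u + X_t` makes `U` affine in `x` and `u`. The second
equation of `newU_equations` then splits into its coefficients at `u`, `x` and `1`. -/
theorem exists_determiningSystem (E : IsEquivalenceOnBox Φ I J K L M) {h H : ℝ} (hh : h ∈ L)
    (hH : ∀ t ∈ I, ∀ x ∈ J, ∀ u ∈ K, ∀ g ∈ M, newH Φ (t, x, u, h, g) = H) :
    ∃ T T' A B P Q R : ℝ → ℝ, (∀ t ∈ I, DeterminingSystem h H T T' A B P Q R t) ∧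
      ∀ t ∈ I, ∀ x ∈ J, ∀ u ∈ K, ∀ g ∈ M, Φ (t, x, u, h, g) =
        (T t, A t * x + B t, P t * u + Q t * x + R t, H, A t * P t * g) := by
  obtain ⟨x₀, hx₀⟩ := E.hJ.nonempty
  obtain ⟨u₀, hu₀⟩ := E.hK.nonempty
  obtain ⟨g₀, hg₀⟩ := E.hM.nonempty
  have hb : ∀ t ∈ I, (t, x₀, u₀, h, g₀) ∈ box I J K L M := fun t ht => ⟨ht, hx₀, hu₀, hh, hg₀⟩
  set T : ℝ → ℝ := fun t => newT Φ (t, x₀, u₀, h, g₀) with hT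
  set T' : ℝ → ℝ := fun t => fderiv ℝ (newT Φ) (t, x₀, u₀, h, g₀) (1, 0, 0, 0, 0) with hT'
  set A : ℝ → ℝ := fun t => fderiv ℝ (newX Φ) (t, x₀, u₀, h, g₀) (0, 1, 0, 0, 0) with hA
  set B : ℝ → ℝ := fun t => newX Φ (t, x₀, u₀, h, g₀) - A t * x₀ with hB
  -- Taking `P`, `Q`, `R` from derivatives of `U` at a base point, not as quotients by `T'`, gives
  -- their differentiability without differentiating `T'`.
  set P : ℝ → ℝ := fun t => fderiv ℝ (newU Φ) (t, x₀, u₀, h, g₀) (0, 0, 1, 0, 0) with hP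
  set Q : ℝ → ℝ := fun t => fderiv ℝ (newU Φ) (t, x₀, u₀, h, g₀) (0, 1, 0, 0, 0) with hQ
  set R : ℝ → ℝ := fun t => newU Φ (t, x₀, u₀, h, g₀) - P t * u₀ - Q t * x₀ with hR
  have hT'ne : ∀ t ∈ I, T' t ≠ 0 := fun t ht => (E.fderiv_newT_g (hb t ht)).1
  have hX : ∀ t ∈ I, ∀ x ∈ J, ∀ u ∈ K, ∀ g ∈ M, newX Φ (t, x, u, h, g) = A t * x + B t :=
    fun t ht x hx u hu g hg => E.newX_affine ⟨ht, hx, hu, hh, hg⟩ (hb t ht)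
  have dA : ∀ t ∈ I, HasDerivAt A (deriv A t) t := fun t ht =>
    (hasDerivAt_slice_t (differentiableAt_fderiv_apply (E.smoothX (hb t ht))
      (0, 1, 0, 0, 0))).differentiableAt.hasDerivAt
  have dB : ∀ t ∈ I, HasDerivAt B (deriv B t) t := fun t ht =>
    ((hasDerivAt_slice_t (E.diffX (hb t ht))).sub
      ((dA t ht).mul_const x₀)).differentiableAt.hasDerivAt
  have dP : ∀ t ∈ I, HasDerivAt P (deriv P t) t := fun t ht =>
    (hasDerivAt_slice_t (differentiableAt_fderiv_apply (E.smoothU (hb t ht))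
      (0, 0, 1, 0, 0))).differentiableAt.hasDerivAt
  have dQ : ∀ t ∈ I, HasDerivAt Q (deriv Q t) t := fun t ht =>
    (hasDerivAt_slice_t (differentiableAt_fderiv_apply (E.smoothU (hb t ht))
      (0, 1, 0, 0, 0))).differentiableAt.hasDerivAt
  have dR : ∀ t ∈ I, HasDerivAt R (deriv R t) t := fun t ht =>
    (((hasDerivAt_slice_t (E.diffU (hb t ht))).sub ((dP t ht).mul_const u₀)).sub
      ((dQ t ht).mul_const x₀)).differentiableAt.hasDerivAt
  have hX2 : ∀ t ∈ I, ∀ x ∈ J, ∀ u ∈ K, ∀ g ∈ M,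
      fderiv ℝ (newX Φ) (t, x, u, h, g) (0, 1, 0, 0, 0) = A t := fun t ht x hx u hu g hg => by
    have h1 := hasDerivAt_slice_x (E.diffX (q := (t, x, u, h, g)) ⟨ht, hx, hu, hh, hg⟩)
    have h2 := ((hasDerivAt_id' x).const_mul (A t)).add_const (B t)
    rw [mul_one] at h2
    refine h1.unique (h2.congr_of_eventuallyEq ?_)
    filter_upwards [E.hJ.isOpen.mem_nhds hx] with y hy using hX t ht y hy u hu g hg
  have hX1 : ∀ t ∈ I, ∀ x ∈ J, ∀ u ∈ K, ∀ g ∈ M,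
      fderiv ℝ (newX Φ) (t, x, u, h, g) (1, 0, 0, 0, 0) = deriv A t * x + deriv B t :=
    fun t ht x hx u hu g hg => by
      have h1 := hasDerivAt_slice_t (E.diffX (q := (t, x, u, h, g)) ⟨ht, hx, hu, hh, hg⟩)
      have h2 := ((dA t ht).mul_const x).add (dB t ht)
      refine h1.unique (h2.congr_of_eventuallyEq ?_)
      filter_upwards [E.hI.isOpen.mem_nhds ht] with s hs using hX s hs x hx u hu g hg
  have hT1 : ∀ t ∈ I, ∀ x ∈ J, ∀ u ∈ K, ∀ g ∈ M,
      fderiv ℝ (newT Φ) (t, x, u, h, g) (1, 0, 0, 0, 0) = T' t := fun t ht x hx u hu g hg => by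
    rw [E.fderiv_newT_eq (t := t) ⟨ht, hx, hu, hh, hg⟩ (hb t ht)]
  have hU : ∀ t ∈ I, ∀ x ∈ J, ∀ u ∈ K, ∀ g ∈ M, newU Φ (t, x, u, h, g) =
      A t / T' t * u + deriv A t / T' t * x + deriv B t / T' t := fun t ht x hx u hu g hg => by
    have h1 := (E.newU_equations (t := t) ⟨ht, hx, hu, hh, hg⟩).1
    rw [hT1 t ht x hx u hu g hg, hX1 t ht x hx u hu g hg, hX2 t ht x hx u hu g hg] at h1
    refine mul_left_cancel₀ (hT'ne t ht) (h1.trans ?_)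
    have := hT'ne t ht
    field_simp
    ring
  have hPeq : ∀ t ∈ I, P t = A t / T' t := fun t ht => by
    have h2 := (((hasDerivAt_id' u₀).const_mul (A t / T' t)).add_const
      (deriv A t / T' t * x₀)).add_const (deriv B t / T' t)
    rw [mul_one] at h2
    refine (hasDerivAt_slice_u (E.diffU (hb t ht))).unique (h2.congr_of_eventuallyEq ?_)
    filter_upwards [E.hK.isOpen.mem_nhds hu₀] with y hy using hU t ht x₀ hx₀ y hy g₀ hg₀
  have hQeq : ∀ t ∈ I, Q t = deriv A t / T' t := fun t ht => by
    have h2 := (((hasDerivAt_id' x₀).const_mul (deriv A t / T' t)).const_add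
      (A t / T' t * u₀)).add_const (deriv B t / T' t)
    rw [mul_one] at h2
    refine (hasDerivAt_slice_x (E.diffU (hb t ht))).unique (h2.congr_of_eventuallyEq ?_)
    filter_upwards [E.hJ.isOpen.mem_nhds hx₀] with y hy using hU t ht y hy u₀ hu₀ g₀ hg₀
  have hReq : ∀ t ∈ I, R t = deriv B t / T' t := fun t ht => by
    simp only [hR]
    rw [hU t ht x₀ hx₀ u₀ hu₀ g₀ hg₀, hPeq t ht, hQeq t ht]
    ring
  have hU' : ∀ t ∈ I, ∀ x ∈ J, ∀ u ∈ K, ∀ g ∈ M,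
      newU Φ (t, x, u, h, g) = P t * u + Q t * x + R t := fun t ht x hx u hu g hg => by
    rw [hU t ht x hx u hu g hg, hPeq t ht, hQeq t ht, hReq t ht]
  refine ⟨T, T', A, B, P, Q, R, fun t ht => ?_, fun t ht x hx u hu g hg => ?_⟩
  · have hA' : deriv A t = Q t * T' t := by rw [hQeq t ht, div_mul_cancel₀ _ (hT'ne t ht)]
    have hB' : deriv B t = R t * T' t := by rw [hReq t ht, div_mul_cancel₀ _ (hT'ne t ht)]
    obtain ⟨cP, cQ, cR⟩ := affine_coeff_eq_zero E.hJ E.hK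
      (a := deriv P t + Q t - h * P t + H * A t) (b := deriv Q t + H * deriv A t)
      (c := deriv R t + H * deriv B t) fun x hx u hu => by
        have hq : (t, x, u, h, g₀) ∈ box I J K L M := ⟨ht, hx, hu, hh, hg₀⟩
        have h1 := (E.newU_equations hq).2
        have u1 : fderiv ℝ (newU Φ) (t, x, u, h, g₀) (1, 0, 0, 0, 0) =
            deriv P t * u + deriv Q t * x + deriv R t := by
          refine (hasDerivAt_slice_t (E.diffU hq)).unique ((((dP t ht).mul_const u).add
            ((dQ t ht).mul_const x)).add (dR t ht) |>.congr_of_eventuallyEq ?_)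
          filter_upwards [E.hI.isOpen.mem_nhds ht] with s hs using hU' s hs x hx u hu g₀ hg₀
        have u2 : fderiv ℝ (newU Φ) (t, x, u, h, g₀) (0, 1, 0, 0, 0) = Q t := by
          have h2 := (((hasDerivAt_id' x).const_mul (Q t)).const_add (P t * u)).add_const (R t)
          rw [mul_one] at h2
          refine (hasDerivAt_slice_x (E.diffU hq)).unique (h2.congr_of_eventuallyEq ?_)
          filter_upwards [E.hJ.isOpen.mem_nhds hx] with y hy using hU' t ht y hy u hu g₀ hg₀
        have u3 : fderiv ℝ (newU Φ) (t, x, u, h, g₀) (0, 0, 1, 0, 0) = P t := by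
          have h2 := (((hasDerivAt_id' u).const_mul (P t)).add_const (Q t * x)).add_const (R t)
          rw [mul_one] at h2
          refine (hasDerivAt_slice_u (E.diffU hq)).unique (h2.congr_of_eventuallyEq ?_)
          filter_upwards [E.hK.isOpen.mem_nhds hu] with y hy using hU' t ht x hx y hy g₀ hg₀
        rw [u1, u2, u3, hH t ht x hx u hu g₀ hg₀, hX1 t ht x hx u hu g₀ hg₀,
          hX2 t ht x hx u hu g₀ hg₀] at h1
        linear_combination h1
    refine ⟨hT'ne t ht, (E.newX_u (hb t ht)).2, ?_, hasDerivAt_slice_t (E.diffT (hb t ht)),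
      hA' ▸ dA t ht, hB' ▸ dB t ht, (dP t ht).congr_deriv ?_, (dQ t ht).congr_deriv ?_,
      (dR t ht).congr_deriv ?_⟩
    · rw [hPeq t ht, div_mul_cancel₀ _ (hT'ne t ht)]
    · linear_combination cP
    · rw [← hA']; linear_combination cQ
    · rw [← hB']; linear_combination cR
  · have hq : (t, x, u, h, g) ∈ box I J K L M := ⟨ht, hx, hu, hh, hg⟩
    refine Prod.ext (E.newT_eq hq (hb t ht)) (Prod.ext (hX t ht x hx u hu g hg)
      (Prod.ext (hU' t ht x hx u hu g hg) (Prod.ext (hH t ht x hx u hu g hg) ?_)))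
    have h1 := E.newX_characteristic hq 0 (E.newX_u hq).2
    rw [hX2 t ht x hx u hu g hg, hT1 t ht x hx u hu g hg] at h1
    change newG Φ (t, x, u, h, g) = A t * P t * g
    refine mul_left_cancel₀ (hT'ne t ht) (h1.symm.trans ?_)
    have := hT'ne t ht
    rw [hPeq t ht]
    field_simp

end IsEquivalenceOnBox

/-! ### Necessity: integration of the determining system. -/

theorem exists_const_of_hasDerivAt_zero {I : Set ℝ} (hI : IsOpenInterval I) {f : ℝ → ℝ}
    (hf : ∀ t ∈ I, HasDerivAt f 0 t) : ∃ c, ∀ t ∈ I, f t = c := by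
  obtain ⟨t₀, ht₀⟩ := hI.nonempty
  exact ⟨f t₀, fun t ht => hI.isOpen.is_const_of_deriv_eq_zero hI.ordConnected.isPreconnected
    (fun s hs => (hf s hs).differentiableAt.differentiableWithinAt)
    (fun s hs => (hf s hs).deriv) ht ht₀⟩

/-- The general solution of the determining system. -/
theorem DeterminingSystem.exists_constants {I : Set ℝ} (hI : IsOpenInterval I) {h h' : ℝ}
    {T T' A B P Q R : ℝ → ℝ} (S : ∀ t ∈ I, DeterminingSystem h h' T T' A B P Q R t) :
    ∃ α β γ δ μ₀ μ₁ : ℝ, α * δ - β * γ ≠ 0 ∧ ∀ t ∈ I, γ * tau h t + δ ≠ 0 ∧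
      tau h' (T t) = (α * tau h t + β) / (γ * tau h t + δ) ∧
      A t = (γ * tau h t + δ)⁻¹ ∧ B t = (μ₁ * tau h t + μ₀) * (γ * tau h t + δ)⁻¹ ∧
      P t = Real.exp (h * t - h' * T t) * (γ * tau h t + δ) / (α * δ - β * γ) ∧
      Q t = -γ * Real.exp (-h' * T t) / (α * δ - β * γ) ∧
      R t = (μ₁ * δ - γ * μ₀) * Real.exp (-h' * T t) / (α * δ - β * γ) := by
  have hPne : ∀ t ∈ I, P t ≠ 0 := fun t ht h0 => (S t ht).A_ne (by rw [(S t ht).A_eq, h0, zero_mul])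
  have dE : ∀ t ∈ I, HasDerivAt (fun t => Real.exp (h' * T t))
      (Real.exp (h' * T t) * (h' * T' t)) t := fun t ht => ((S t ht).derivT.const_mul h').exp
  have dτ' : ∀ t ∈ I, HasDerivAt (fun t => tau h' (T t)) ((Real.exp (h' * T t))⁻¹ * T' t) t :=
    fun t ht => by
      have := (hasDerivAt_tau h' (T t)).comp t (S t ht).derivT
      rwa [neg_mul, Real.exp_neg] at this
  have dτ : ∀ t, HasDerivAt (tau h) (Real.exp (h * t))⁻¹ t := fun t => by
    have := hasDerivAt_tau h t
    rwa [neg_mul, Real.exp_neg] at this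
  have dW : ∀ t, HasDerivAt (fun t => (Real.exp (h * t))⁻¹) (-h * (Real.exp (h * t))⁻¹) t :=
    fun t => by
      simp only [← Real.exp_neg]
      refine (((hasDerivAt_id' t).const_mul h).fun_neg.exp).congr_deriv ?_
      ring
  -- First integrals: `Q e^{h'T}` and `R e^{h'T}`; then `A` and `B` are affine in `τ_{h'}(T)`, since
  -- the derivative of the latter is `e^{-h'T} T'`.
  obtain ⟨c₁, hc₁⟩ := exists_const_of_hasDerivAt_zero hI (f := fun t => Q t * Real.exp (h' * T t))
    fun t ht => ((S t ht).derivQ.mul (dE t ht)).congr_deriv (by ring)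
  obtain ⟨d₁, hd₁⟩ := exists_const_of_hasDerivAt_zero hI (f := fun t => R t * Real.exp (h' * T t))
    fun t ht => ((S t ht).derivR.mul (dE t ht)).congr_deriv (by ring)
  obtain ⟨c₀, hc₀⟩ := exists_const_of_hasDerivAt_zero hI (f := fun t => A t - c₁ * tau h' (T t))
    fun t ht => ((S t ht).derivA.sub ((dτ' t ht).const_mul c₁)).congr_deriv (by
      rw [← hc₁ t ht]; have := Real.exp_ne_zero (h' * T t); field_simp; ring)
  obtain ⟨d₀, hd₀⟩ := exists_const_of_hasDerivAt_zero hI (f := fun t => B t - d₁ * tau h' (T t))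
    fun t ht => ((S t ht).derivB.sub ((dτ' t ht).const_mul d₁)).congr_deriv (by
      rw [← hd₁ t ht]; have := Real.exp_ne_zero (h' * T t); field_simp; ring)
  obtain ⟨k, hk⟩ := exists_const_of_hasDerivAt_zero hI
    (f := fun t => A t * P t * Real.exp (h' * T t) * (Real.exp (h * t))⁻¹)
    fun t ht => ((((S t ht).derivA.mul (S t ht).derivP).mul (dE t ht)).mul (dW t)).congr_deriv (by
      simp only [Pi.mul_apply]; rw [(S t ht).A_eq]; ring)
  obtain ⟨t₀, ht₀⟩ := hI.nonempty
  have hk0 : k ≠ 0 := by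
    rw [← hk t₀ ht₀]
    exact mul_ne_zero (mul_ne_zero (mul_ne_zero (S t₀ ht₀).A_ne (hPne t₀ ht₀))
      (Real.exp_ne_zero _)) (inv_ne_zero (Real.exp_ne_zero _))
  -- The integral `k` turns `(A⁻¹)' = -Q T' / A²` into `-(c₁/k) e^{-ht}`, so `A⁻¹` is affine in
  -- `τ_h`; likewise `τ_{h'}(T) A⁻¹`. Their quotient is the Möbius map.
  obtain ⟨δ, hδ⟩ := exists_const_of_hasDerivAt_zero hI
    (f := fun t => (A t)⁻¹ + c₁ / k * tau h t)
    fun t ht => (((S t ht).derivA.inv (S t ht).A_ne).add ((dτ t).const_mul (c₁ / k))).congr_deriv (by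
      have h1 := (S t ht).A_ne
      have h2 := hPne t ht
      have h3 := (S t ht).T'_ne
      have h4 := Real.exp_ne_zero (h' * T t)
      have h5 := Real.exp_ne_zero (h * t)
      rw [← hk t ht, ← hc₁ t ht, (S t ht).A_eq]
      field_simp
      ring)
  obtain ⟨β, hβ⟩ := exists_const_of_hasDerivAt_zero hI
    (f := fun t => tau h' (T t) * (A t)⁻¹ - c₀ / k * tau h t)
    fun t ht => (((dτ' t ht).mul ((S t ht).derivA.inv (S t ht).A_ne)).sub
      ((dτ t).const_mul (c₀ / k))).congr_deriv (by
      have h1 := (S t ht).A_ne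
      have h2 := hPne t ht
      have h3 := (S t ht).T'_ne
      have h4 := Real.exp_ne_zero (h' * T t)
      have h5 := Real.exp_ne_zero (h * t)
      rw [← hk t ht, ← hc₀ t ht, ← hc₁ t ht]
      simp only [Pi.inv_apply]
      rw [(S t ht).A_eq]
      field_simp
      ring)
  have hN : ∀ t ∈ I, -(c₁ / k) * tau h t + δ = (A t)⁻¹ := fun t ht => by
    rw [← hδ t ht]; ring
  -- The scale of `(α, β, γ, δ)` is fixed by `A = (γτ + δ)⁻¹`, so that the determinant comes out as
  -- `1/k`.
  have hΔ : c₀ / k * δ - β * -(c₁ / k) = k⁻¹ := by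
    have h1 := (S t₀ ht₀).A_ne
    rw [← hδ t₀ ht₀, ← hβ t₀ ht₀, ← hc₀ t₀ ht₀]
    field_simp
    ring
  -- `μ₀` and `μ₁` come from `B = d₁ τ_{h'}(T) + d₀` multiplied by `γτ + δ`: the result is `d₁ (ατ +
  -- β) + d₀ (γτ + δ)`.
  refine ⟨c₀ / k, β, -(c₁ / k), δ, d₁ * β + d₀ * δ, d₁ * (c₀ / k) + d₀ * -(c₁ / k), ?_,
    fun t ht => ?_⟩
  · rw [hΔ]; exact inv_ne_zero hk0
  have hA := (S t ht).A_ne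
  have hE := Real.exp_ne_zero (h' * T t)
  have hW := Real.exp_ne_zero (h * t)
  have hτ' : c₀ / k * tau h t + β = tau h' (T t) * (A t)⁻¹ := by rw [← hβ t ht]; ring
  have hB : (d₁ * (c₀ / k) + d₀ * -(c₁ / k)) * tau h t + (d₁ * β + d₀ * δ) =
      d₁ * (tau h' (T t) * (A t)⁻¹) + d₀ * (A t)⁻¹ := by
    rw [← hτ', ← hN t ht]; ring
  have hμ : (d₁ * (c₀ / k) + d₀ * -(c₁ / k)) * δ - -(c₁ / k) * (d₁ * β + d₀ * δ) = d₁ * k⁻¹ := by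
    rw [← hΔ]; ring
  rw [hN t ht, hΔ, hB, hμ, hτ']
  refine ⟨inv_ne_zero hA, ?_, (inv_inv _).symm, ?_, ?_, ?_, ?_⟩
  · field_simp
  · rw [← hd₀ t ht]; field_simp; ring
  · rw [Real.exp_sub, ← hk t ht]; field_simp
  · rw [neg_mul h', Real.exp_neg, ← hc₁ t ht]; field_simp
  · rw [neg_mul h', Real.exp_neg, ← hd₁ t ht]; field_simp

/-! ### Necessity: smooth dependence of the constants on `h`. -/

/-- The coefficients of a function `p(h) τ_h(t) + q(h)` that is smooth in `h` are smooth. -/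
theorem contDiffOn_coeff_of_tau {I L : Set ℝ} (hI : IsOpenInterval I) {f : ℝ → ℝ → ℝ} {p q : ℝ → ℝ}
    (hf : ∀ t ∈ I, ContDiffOn ℝ ∞ (f t) L) (heq : ∀ h ∈ L, ∀ t ∈ I, p h * tau h t + q h = f t h) :
    ContDiffOn ℝ ∞ p L ∧ ContDiffOn ℝ ∞ q L := by
  obtain ⟨t₀, ht₀⟩ := hI.nonempty
  obtain ⟨t₁, ht₁, hne⟩ := hI.exists_ne ht₀
  have hτ : ∀ t : ℝ, ContDiffOn ℝ ∞ (fun h => tau h t) L := fun t =>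
    (contDiff_tau.comp (f := fun h : ℝ => (h, t)) (by fun_prop)).contDiffOn
  have hτne : ∀ h ∈ L, tau h t₁ - tau h t₀ ≠ 0 := fun h _ =>
    sub_ne_zero.2 fun h0 => hne (tau_injective h h0)
  have hp : ContDiffOn ℝ ∞ p L := by
    refine ((((hf t₁ ht₁).sub (hf t₀ ht₀))).div ((hτ t₁).sub (hτ t₀)) hτne).congr fun h hh => ?_
    rw [Pi.div_apply, eq_div_iff (hτne h hh), ← heq h hh t₁ ht₁, ← heq h hh t₀ ht₀]
    ring
  refine ⟨hp, ((hf t₀ ht₀).sub (hp.mul (hτ t₀))).congr fun h hh => ?_⟩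
  rw [← heq h hh t₀ ht₀]
  simp

namespace IsEquivalenceOnBox

variable {Φ : ExtPt → ExtPt} {I J K L M : Set ℝ}

/-- Every generalized equivalence transformation has the normal form. -/
theorem exists_parameterFamily (E : IsEquivalenceOnBox Φ I J K L M) :
    ∃ H α β γ δ μ₀ μ₁ : ℝ → ℝ, IsParameterFamily I L H α β γ δ μ₀ μ₁ ∧
      EqOn Φ (normalForm H α β γ δ μ₀ μ₁) (I ×ˢ J ×ˢ K ×ˢ L ×ˢ M) := by
  obtain ⟨t₀, ht₀⟩ := E.hI.nonempty
  obtain ⟨x₀, hx₀⟩ := E.hJ.nonempty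
  obtain ⟨u₀, hu₀⟩ := E.hK.nonempty
  obtain ⟨g₀, hg₀⟩ := E.hM.nonempty
  obtain ⟨x₁, hx₁, hx⟩ := E.hJ.exists_ne hx₀
  set H : ℝ → ℝ := fun h => newH Φ (t₀, x₀, u₀, h, g₀) with hHdef
  have hH : ∀ h ∈ L, ∀ t ∈ I, ∀ x ∈ J, ∀ u ∈ K, ∀ g ∈ M, newH Φ (t, x, u, h, g) = H h :=
    fun h hh t ht x hx u hu g hg => E.newH_eq ⟨ht, hx, hu, hh, hg⟩ ⟨ht₀, hx₀, hu₀, hh, hg₀⟩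
  -- The constants are found for each `h` separately; the membership `h ∈ L` is moved behind the
  -- existential so that `choose` yields functions on all of `ℝ`.
  have main : ∀ h : ℝ, ∃ α β γ δ μ₀ μ₁ : ℝ, h ∈ L → α * δ - β * γ ≠ 0 ∧
      ∀ t ∈ I, γ * tau h t + δ ≠ 0 ∧ ∃ T, tau (H h) T = (α * tau h t + β) / (γ * tau h t + δ) ∧
        ∀ x ∈ J, ∀ u ∈ K, ∀ g ∈ M, Φ (t, x, u, h, g) = (T, coeffA h γ δ t * x +
          coeffB h γ δ μ₀ μ₁ t, coeffP h (H h) α β γ δ t * u + coeffQ h (H h) α β γ δ t * x +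
          coeffR h (H h) α β γ δ μ₀ μ₁ t, H h, coeffA h γ δ t * coeffP h (H h) α β γ δ t * g) := by
    intro h
    by_cases hh : h ∈ L
    · obtain ⟨T, T', A, B, P, Q, R, hS, hΦ⟩ := E.exists_determiningSystem hh (hH h hh)
      obtain ⟨α, β, γ, δ, μ₀, μ₁, hΔ, hc⟩ := DeterminingSystem.exists_constants E.hI hS
      refine ⟨α, β, γ, δ, μ₀, μ₁, fun _ => ⟨hΔ, fun t ht => ?_⟩⟩
      obtain ⟨hN, hT, eA, eB, eP, eQ, eR⟩ := hc t ht
      refine ⟨hN, T t, hT, fun x hx u hu g hg => ?_⟩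
      rw [hΦ t ht x hx u hu g hg, eA, eB, eP, eQ, eR]
      simp only [coeffA, coeffB, coeffP, coeffQ, coeffR, ← eq_newTime hT]
    · exact ⟨0, 0, 0, 0, 0, 0, fun h1 => absurd h1 hh⟩
  choose α β γ δ μ₀ μ₁ hmain using main
  have hform : EqOn Φ (normalForm H α β γ δ μ₀ μ₁) (I ×ˢ J ×ˢ K ×ˢ L ×ˢ M) := by
    rintro ⟨t, x, u, h, g⟩ ⟨ht, hx, hu, hh, hg⟩
    obtain ⟨-, T, hT, hΦ⟩ := (hmain h hh).2 t ht
    rw [hΦ x hx u hu g hg, eq_newTime hT]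
    rfl
  -- The choice carries no regularity in `h`. It is recovered by expressing `γτ + δ`, `ατ + β` and
  -- `μ₁τ + μ₀` at fixed `t` through `Φ`, which is smooth in `h`.
  have hslice : ∀ t ∈ I, ∀ x ∈ J, ContDiffOn ℝ ∞ (fun h => Φ (t, x, u₀, h, g₀)) L :=
    fun t ht x hx => E.hΦ.1.comp (f := fun h => (t, x, u₀, h, g₀)) (by fun_prop)
      fun h hh => ⟨ht, hx, hu₀, hh, hg₀⟩
  have sH : ContDiffOn ℝ ∞ H L := (hslice t₀ ht₀ x₀ hx₀).snd.snd.snd.fst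
  have hN : ∀ h ∈ L, ∀ t ∈ I, γ h * tau h t + δ h ≠ 0 := fun h hh t ht => ((hmain h hh).2 t ht).1
  have fX : ∀ t ∈ I, ∀ x ∈ J, ∀ h ∈ L, (Φ (t, x, u₀, h, g₀)).2.1 =
      (γ h * tau h t + δ h)⁻¹ * x + (μ₁ h * tau h t + μ₀ h) * (γ h * tau h t + δ h)⁻¹ :=
    fun t ht x hx h hh => by
      rw [hform (show (t, x, u₀, h, g₀) ∈ I ×ˢ J ×ˢ K ×ˢ L ×ˢ M from ⟨ht, hx, hu₀, hh, hg₀⟩)]; rfl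
  have fT : ∀ t ∈ I, ∀ h ∈ L, tau (H h) (Φ (t, x₀, u₀, h, g₀)).1 =
      (α h * tau h t + β h) / (γ h * tau h t + δ h) := fun t ht h hh => by
    obtain ⟨-, T, hT, hΦ⟩ := (hmain h hh).2 t ht
    rw [hΦ x₀ hx₀ u₀ hu₀ g₀ hg₀, hT]
  have sA : ∀ t ∈ I, ContDiffOn ℝ ∞ (fun h => γ h * tau h t + δ h) L := fun t ht => by
    -- The difference quotient of the new `x` between `x₀` and `x₁` is `A`, the inverse of `γτ + δ`.
    have h1 : ContDiffOn ℝ ∞ (fun h => ((Φ (t, x₁, u₀, h, g₀)).2.1 -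
        (Φ (t, x₀, u₀, h, g₀)).2.1) / (x₁ - x₀)) L :=
      ((hslice t ht x₁ hx₁).snd.fst.sub (hslice t ht x₀ hx₀).snd.fst).div_const _
    have h2 : ∀ h ∈ L, ((Φ (t, x₁, u₀, h, g₀)).2.1 - (Φ (t, x₀, u₀, h, g₀)).2.1) / (x₁ - x₀) =
        (γ h * tau h t + δ h)⁻¹ := fun h hh => by
      rw [fX t ht x₁ hx₁ h hh, fX t ht x₀ hx₀ h hh, div_eq_iff (sub_ne_zero.2 hx)]
      ring
    refine (h1.inv fun h hh => ?_).congr fun h hh => ?_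
    · rw [h2 h hh]; exact inv_ne_zero (hN h hh t ht)
    · rw [Pi.inv_apply, h2 h hh, inv_inv]
  have sαβ : ∀ t ∈ I, ContDiffOn ℝ ∞ (fun h => α h * tau h t + β h) L := fun t ht => by
    have h1 : ContDiffOn ℝ ∞ (fun h => tau (H h) (Φ (t, x₀, u₀, h, g₀)).1) L :=
      contDiff_tau.comp_contDiffOn (f := fun h => (H h, (Φ (t, x₀, u₀, h, g₀)).1))
        (sH.prodMk (hslice t ht x₀ hx₀).fst)
    refine (h1.mul (sA t ht)).congr fun h hh => ?_
    simp only [fT t ht h hh, div_mul_cancel₀ _ (hN h hh t ht)]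
  have sμ : ∀ t ∈ I, ContDiffOn ℝ ∞ (fun h => μ₁ h * tau h t + μ₀ h) L := fun t ht => by
    refine (((hslice t ht x₀ hx₀).snd.fst.mul (sA t ht)).sub
      (contDiffOn_const (c := x₀))).congr fun h hh => ?_
    have := hN h hh t ht
    simp only [fX t ht x₀ hx₀ h hh]
    generalize γ h * tau h t + δ h = N at *
    field_simp
    ring
  obtain ⟨sγ, sδ⟩ := contDiffOn_coeff_of_tau E.hI sA fun _ _ _ _ => rfl
  obtain ⟨sα, sβ⟩ := contDiffOn_coeff_of_tau E.hI sαβ fun _ _ _ _ => rfl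
  obtain ⟨sμ₁, sμ₀⟩ := contDiffOn_coeff_of_tau E.hI sμ fun _ _ _ _ => rfl
  refine ⟨H, α, β, γ, δ, μ₀, μ₁, ⟨sH, sα, sβ, sγ, sδ, sμ₀, sμ₁, fun h hh h0 => ?_,
    fun h hh => (hmain h hh).1, hN, fun h hh t ht => ?_⟩, hform⟩
  · -- the Jacobian matrix would have a zero row
    have hq : (t₀, x₀, u₀, h, g₀) ∈ box I J K L M := ⟨ht₀, hx₀, hu₀, hh, hg₀⟩
    obtain ⟨v, hv⟩ := surjective_of_det_ne_zero _ (E.hΦ.2.1 _ hq) (0, 0, 0, 1, 0)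
    have h1 : HasFDerivAt (newH Φ) _ (t₀, x₀, u₀, h, g₀) := (E.hasFDerivAt hq).snd.snd.snd.fst
    have h2 : HasDerivAt H (deriv H h) h :=
      ((sH.contDiffAt (E.hL.isOpen.mem_nhds hh)).differentiableAt (by simp)).hasDerivAt
    have h3 : HasFDerivAt (fun q : ExtPt => H q.2.2.2.1) _ (t₀, x₀, u₀, h, g₀) :=
      HasDerivAt.comp_hasFDerivAt (t₀, x₀, u₀, h, g₀) (f := fun q : ExtPt => q.2.2.2.1) h2
        (ContinuousLinearMap.fst ℝ ℝ ℝ ∘L ContinuousLinearMap.snd ℝ ℝ (ℝ × ℝ) ∘L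
          ContinuousLinearMap.snd ℝ ℝ (ℝ × ℝ × ℝ) ∘L
          ContinuousLinearMap.snd ℝ ℝ (ℝ × ℝ × ℝ × ℝ)).hasFDerivAt
    have h4 : newH Φ =ᶠ[𝓝 (t₀, x₀, u₀, h, g₀)] fun q : ExtPt => H q.2.2.2.1 := by
      filter_upwards [E.eventually_mem hq] with y hy
      exact hH _ hy.2.2.2.1 _ hy.1 _ hy.2.1 _ hy.2.2.1 _ hy.2.2.2.2
    have h5 := h1.unique (h3.congr_of_eventuallyEq h4)
    rw [h0, zero_smul] at h5
    have h6 := DFunLike.congr_fun h5 v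
    have h7 : (fderiv ℝ Φ (t₀, x₀, u₀, h, g₀) v).2.2.2.1 = 0 := h6
    rw [hv] at h7
    exact one_ne_zero h7
  · obtain ⟨-, T, hT, -⟩ := (hmain h hh).2 t ht
    exact ⟨T, hT⟩

end IsEquivalenceOnBox

end Burgers

/-! ### The main theorem. -/

theorem mainTheorem6 (I J K L M : Set ℝ)
    (hI : IsOpenInterval I) (hJ : IsOpenInterval J) (hK : IsOpenInterval K)
    (hL : IsOpenInterval L) (hM : IsOpenInterval M) (hM0 : (0 : ℝ) ∉ M)
    (Φ : Burgers.ExtPt → Burgers.ExtPt) :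
    Burgers.IsGeneralizedEquivalence Φ I J K L M ↔
      ∃ H α β γ δ μ₀ μ₁ : ℝ → ℝ,
        ContDiffOn ℝ ∞ H L ∧ ContDiffOn ℝ ∞ α L ∧ ContDiffOn ℝ ∞ β L ∧
        ContDiffOn ℝ ∞ γ L ∧ ContDiffOn ℝ ∞ δ L ∧
        ContDiffOn ℝ ∞ μ₀ L ∧ ContDiffOn ℝ ∞ μ₁ L ∧
        (∀ h ∈ L, deriv H h ≠ 0) ∧
        (∀ h ∈ L, α h * δ h - β h * γ h ≠ 0) ∧
        (∀ h ∈ L, ∀ t ∈ I, γ h * Burgers.tau h t + δ h ≠ 0) ∧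
        ∀ t ∈ I, ∀ x ∈ J, ∀ u ∈ K, ∀ h ∈ L, ∀ g ∈ M,
          ∃ T : ℝ,
            Burgers.tau (H h) T =
              (α h * Burgers.tau h t + β h) / (γ h * Burgers.tau h t + δ h) ∧
            Φ (t, x, u, h, g) =
              (T,
               (x + μ₁ h * Burgers.tau h t + μ₀ h) * Burgers.X1 h (γ h) (δ h) t,
               Real.exp (h * t - H h * T) /
                  ((α h * δ h - β h * γ h) * Burgers.X1 h (γ h) (δ h) t) *
                (u + (x + μ₁ h * Burgers.tau h t + μ₀ h) *
                    (deriv (Burgers.X1 h (γ h) (δ h)) t / Burgers.X1 h (γ h) (δ h) t)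
                  + μ₁ h * Real.exp (-h * t)),
               H h,
               Real.exp (h * t - H h * T) / (α h * δ h - β h * γ h) * g)
 := by
  constructor
  · intro hΦ
    obtain ⟨H, α, β, γ, δ, μ₀, μ₁, F, hform⟩ :=
      Burgers.IsEquivalenceOnBox.exists_parameterFamily ⟨hI, hJ, hK, hL, hM, hM0, hΦ⟩
    refine ⟨H, α, β, γ, δ, μ₀, μ₁, F.smoothH, F.smoothα, F.smoothβ, F.smoothγ, F.smoothδ,
      F.smoothμ₀, F.smoothμ₁, F.derivH, F.det_ne, F.denom_ne,
      fun t ht x hx u hu h hh g hg => ?_⟩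
    obtain ⟨T, hT⟩ := F.range h hh t ht
    refine ⟨T, hT, ?_⟩
    rw [Burgers.formula_eq_normalForm (F.det_ne h hh) (F.denom_ne h hh t ht) hT]
    exact hform ⟨ht, hx, hu, hh, hg⟩
  · rintro ⟨H, α, β, γ, δ, μ₀, μ₁, sH, sα, sβ, sγ, sδ, sμ₀, sμ₁, hH, hΔ, hN, hform⟩
    obtain ⟨x₀, hx₀⟩ := hJ.nonempty
    obtain ⟨u₀, hu₀⟩ := hK.nonempty
    obtain ⟨g₀, hg₀⟩ := hM.nonempty
    -- In the statement `T` is chosen for each point `(t, x, u, h, g)`; its equation involves only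
    -- `t` and `h`, so one base point in `x, u, g` provides the range condition.
    have F : Burgers.IsParameterFamily I L H α β γ δ μ₀ μ₁ :=
      ⟨sH, sα, sβ, sγ, sδ, sμ₀, sμ₁, hH, hΔ, hN, fun h hh t ht =>
        let ⟨T, hT, _⟩ := hform t ht x₀ hx₀ u₀ hu₀ h hh g₀ hg₀
        ⟨T, hT⟩⟩
    refine Burgers.isGeneralizedEquivalence_of_eqOn hI.isOpen hJ.isOpen hK.isOpen hL.isOpen
      hM.isOpen F ?_
    rintro ⟨t, x, u, h, g⟩ ⟨ht, hx, hu, hh, hg⟩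
    obtain ⟨T, hT, hΦ⟩ := hform t ht x hx u hu h hh g hg
    rw [hΦ, Burgers.formula_eq_normalForm (hΔ h hh) (hN h hh t ht) hT]
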